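/- Let $n\ge 2$, let $F:\mathbb{R}^n\to\mathbb{R}$ be a smooth function having $1$ as a regular value, and let $\Omega\subset\mathbb{R}^n$ be a domain (nonempty, open, connected) with $\partial\Omega=F^{-1}(1)$, whose outward unit normal $\bar N$ along $\partial\Omega$ is $\bar N=\nabla F/|\nabla F|$. Let $\Sigma$ be a compact smooth $(n-1)$-dimensional manifold with (possibly empty) boundary, smoothly immersed in $\overline\Omega$ with $\partial\Sigma$ mapped into $\partial\Omega$, and equipped with the metric induced by the immersion. Suppose that $\Sigma$ is free-boundary, i.e. its outward unit conormal $\nu$ along $\partial\Sigma$ satisfies $\nu=\bar N$. Then for every $\varphi\in C^\infty(\Sigma)$ the following integrals converge absolutely and $$\int_{\partial\Sigma}|\nabla F|\,\varphi\,ds=\int_\Sigma\varphi\,\Delta_\Sigma F\,d\Sigma+\int_\Sigma(1-F)\,\Delta_\Sigma\varphi\,d\Sigma ,$$ where $\Delta_\Sigma$ is the Laplace–Beltrami operator of $\Sigma$, and $F$, $|\nabla F|$ stand for their compositions with the immersion. In particular, $$\int_{\partial\Sigma}|\nabla F|\,ds=\int_\Sigma\Delta_\Sigma F\,d\Sigma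 .$$ -/

import Mathlib

open Set Filter Topology MeasureTheory
open scoped Manifold ContDiff InnerProductSpace

noncomputable section

/-! ### Domains and their outward normal -/

/-- `v` is the outward unit normal of the domain `Ω ⊆ ℝⁿ` at the boundary point `x`: it is a unit
vector, it is orthogonal to all directions tangent to `∂Ω` at `x`, and it points from `Ω` to the
complement of its closure. -/
structure IsOutwardUnitNormal {n : ℕ} (Ω : Set (EuclideanSpace ℝ (Fin n)))
    (x v : EuclideanSpace ℝ (Fin n)) : Prop where
  norm_eq_one : ‖v‖ = 1
  orthogonal : ∀ w ∈ tangentConeAt ℝ (frontier Ω) x, ⟪w, v⟫_ℝ = 0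
  outward : ∀ᶠ t : ℝ in 𝓝[>] 0, x + t • v ∉ closure Ω ∧ x - t • v ∈ Ω

/-! ### Linear algebra of an injective linear map `A : ℝᵐ → ℝⁿ` -/

/-- The Gram operator `A†A` of `A`; its matrix in the standard basis is `(⟪A eᵢ, A eⱼ⟫)ᵢⱼ`. -/
def gramOp {m n : ℕ} (A : EuclideanSpace ℝ (Fin m) →L[ℝ] EuclideanSpace ℝ (Fin n)) :
    EuclideanSpace ℝ (Fin m) →L[ℝ] EuclideanSpace ℝ (Fin m) :=
  (ContinuousLinearMap.adjoint A) ∘L A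

/-- The volume density `√det (⟪A eᵢ, A eⱼ⟫)ᵢⱼ` of the linear map `A`. -/
def volDensity {m n : ℕ} (A : EuclideanSpace ℝ (Fin m) →L[ℝ] EuclideanSpace ℝ (Fin n)) : ℝ :=
  √(gramOp A).det

/-- For injective `A`, the orthogonal projection of `ℝⁿ` to the range of `A`, followed by the
inverse of `A` on its range. -/
def tangentialPart {m n : ℕ} (A : EuclideanSpace ℝ (Fin m) →L[ℝ] EuclideanSpace ℝ (Fin n)) :
    EuclideanSpace ℝ (Fin n) →L[ℝ] EuclideanSpace ℝ (Fin m) :=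
  (gramOp A).inverse ∘L (ContinuousLinearMap.adjoint A)

/-- The inclusion `ℝᵏ → ℝᵏ⁺¹`, `y ↦ (0, y)`, of the hyperplane bounding the half space
`{x | 0 ≤ x₀}`. -/
def faceInclusion (k : ℕ) : EuclideanSpace ℝ (Fin k) →L[ℝ] EuclideanSpace ℝ (Fin (k + 1)) :=
  LinearMap.toContinuousLinearMap
    { toFun := fun y => WithLp.toLp 2 (Fin.cons 0 y.ofLp)
      map_add' := fun y z => by
        ext i
        refine Fin.cases ?_ (fun j => ?_) i <;> simp
      map_smul' := fun a y => by
        ext i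
        refine Fin.cases ?_ (fun j => ?_) i <;> simp }

/-! ### Immersed hypersurfaces

`M` is a manifold with boundary of dimension `k + 1`, modelled on the half space `{x | 0 ≤ x₀}` of
`ℝᵏ⁺¹`, and `ψ : M → ℝⁿ` is an immersion. All notions below refer to the metric induced by `ψ`. -/

section Hypersurface

variable (k : ℕ) {n : ℕ} {M : Type*} [TopologicalSpace M] [ChartedSpace (EuclideanHalfSpace (k + 1)) M]

/-- The differential `dg_p : T_pM → ℝˡ` of a map `g : M → ℝˡ`, the tangent space being identified
with `ℝᵏ⁺¹` by means of the preferred chart at `p`. -/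
def diffAt {l : ℕ} (g : M → EuclideanSpace ℝ (Fin l)) (p : M) :
    EuclideanSpace ℝ (Fin (k + 1)) →L[ℝ] EuclideanSpace ℝ (Fin l) :=
  mfderiv (𝓡∂ (k + 1)) 𝓘(ℝ, EuclideanSpace ℝ (Fin l)) g p

/-- The differential `df_p : T_pM → ℝ` of a function on `M`. -/
def functionDiffAt (f : M → ℝ) (p : M) : EuclideanSpace ℝ (Fin (k + 1)) →L[ℝ] ℝ :=
  mfderiv (𝓡∂ (k + 1)) 𝓘(ℝ, ℝ) f p

/-- `v` is the outward unit conormal of `ψ` at the boundary point `p` of `M`: a unit vector,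
tangent to the hypersurface, orthogonal to the boundary of the hypersurface, and pointing out of
the hypersurface. (At a boundary point, `w ∈ T_pM` is tangent to `∂M` if `w₀ = 0` and points
out of `M` if `w₀ < 0`.) -/
structure IsOutwardConormal (ψ : M → EuclideanSpace ℝ (Fin n)) (p : M)
    (v : EuclideanSpace ℝ (Fin n)) : Prop where
  norm_eq_one : ‖v‖ = 1
  tangent_outward : ∃ w : EuclideanSpace ℝ (Fin (k + 1)), w 0 < 0 ∧ diffAt k ψ p w = v
  orthogonal : ∀ u : EuclideanSpace ℝ (Fin (k + 1)), u 0 = 0 → ⟪diffAt k ψ p u, v⟫_ℝ = 0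

/-- The gradient of `f` for the metric induced by `ψ`, as a vector field along `ψ`: the vector
`∇f = dψ_p ξ` such that `⟪∇f, dψ_p u⟫ = df_p u` for all `u ∈ T_pM`. -/
def surfaceGradient (ψ : M → EuclideanSpace ℝ (Fin n)) (f : M → ℝ) (p : M) :
    EuclideanSpace ℝ (Fin n) :=
  diffAt k ψ p ((gramOp (diffAt k ψ p)).inverse
    ((InnerProductSpace.toDual ℝ (EuclideanSpace ℝ (Fin (k + 1)))).symm (functionDiffAt k f p)))

/-- The divergence of a tangent vector field `X` along `ψ`: the trace of its covariant derivative
`u ↦ (dX_p u)ᵀ`, where `ᵀ` is the orthogonal projection to the tangent space. -/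
def surfaceDivergence (ψ X : M → EuclideanSpace ℝ (Fin n)) (p : M) : ℝ :=
  LinearMap.trace ℝ (EuclideanSpace ℝ (Fin (k + 1)))
    (tangentialPart (diffAt k ψ p) ∘L diffAt k X p :
      EuclideanSpace ℝ (Fin (k + 1)) →L[ℝ] EuclideanSpace ℝ (Fin (k + 1)))

/-- The Laplace-Beltrami operator `Δf = div ∇f` of the metric induced by `ψ`. -/
def laplaceBeltrami (ψ : M → EuclideanSpace ℝ (Fin n)) (f : M → ℝ) : M → ℝ :=
  surfaceDivergence k ψ (surfaceGradient k ψ f)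

/-- The differential at `y` of `ψ` in the coordinates of the chart around `c`. -/
def chartDiff (ψ : M → EuclideanSpace ℝ (Fin n)) (c : M) (y : EuclideanSpace ℝ (Fin (k + 1))) :
    EuclideanSpace ℝ (Fin (k + 1)) →L[ℝ] EuclideanSpace ℝ (Fin n) :=
  fderivWithin ℝ (ψ ∘ (extChartAt (𝓡∂ (k + 1)) c).symm) (range (𝓡∂ (k + 1))) y

variable [IsManifold (𝓡∂ (k + 1)) ∞ M] [T2Space M] [CompactSpace M]

variable (M) in
/-- A smooth partition of unity `(ρ_c)` subordinate to the atlas: the support of `ρ_c` lies in the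
domain of the chart around `c`. -/
def chartPartition : SmoothPartitionOfUnity M (𝓡∂ (k + 1)) M univ :=
  Classical.choose (SmoothPartitionOfUnity.exists_isSubordinate_chartAt_source (𝓡∂ (k + 1)) M)

variable [MeasurableSpace M]

/-- The Riemannian measure on `M` of the metric induced by `ψ`:
`∫ f = ∑_c ∫ ρ_c f √det g dy` in the chart around `c`, where `g` is the matrix of the metric in
these coordinates. -/
def areaMeasure (ψ : M → EuclideanSpace ℝ (Fin n)) : Measure M :=
  Measure.sum fun c : M =>
    ((volume.restrict (extChartAt (𝓡∂ (k + 1)) c).target).withDensity fun y =>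
      ENNReal.ofReal (chartPartition k M c ((extChartAt (𝓡∂ (k + 1)) c).symm y) *
        volDensity (chartDiff k ψ c y))).map (extChartAt (𝓡∂ (k + 1)) c).symm

/-- The Riemannian measure of `∂M` for the metric induced by `ψ`, as a measure on `M`
concentrated on `∂M`: `∫ f = ∑_c ∫ ρ_c f √det h dy` over the boundary `{(0, y)}` of the chart
around `c`, where `h` is the matrix of the metric of `∂M` in the coordinates `y`. -/
def boundaryMeasure (ψ : M → EuclideanSpace ℝ (Fin n)) : Measure M :=
  Measure.sum fun c : M =>
    ((volume.restrict (faceInclusion k ⁻¹' (extChartAt (𝓡∂ (k + 1)) c).target)).withDensity fun y =>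
      ENNReal.ofReal
        (chartPartition k M c ((extChartAt (𝓡∂ (k + 1)) c).symm (faceInclusion k y)) *
          volDensity (chartDiff k ψ c (faceInclusion k y) ∘L faceInclusion k))).map
      fun y => (extChartAt (𝓡∂ (k + 1)) c).symm (faceInclusion k y)

end Hypersurface

/-- The immersion `ψ` of the manifold with boundary `M` is a free-boundary hypersurface in the
domain `Ω` with outward unit normal `N`: it is contained in `Ω` up to its boundary, its boundary
lies on `∂Ω`, and its outward conormal along the boundary is `N`. -/
structure IsFreeBoundaryHypersurface {k : ℕ} {M : Type*} [TopologicalSpace M]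
    [ChartedSpace (EuclideanHalfSpace (k + 1)) M]
    (Ω : Set (EuclideanSpace ℝ (Fin (k + 2))))
    (N : EuclideanSpace ℝ (Fin (k + 2)) → EuclideanSpace ℝ (Fin (k + 2)))
    (ψ : M → EuclideanSpace ℝ (Fin (k + 2))) : Prop where
  smooth : ContMDiff (𝓡∂ (k + 1)) 𝓘(ℝ, EuclideanSpace ℝ (Fin (k + 2))) ∞ ψ
  immersion : ∀ p, Function.Injective (diffAt k ψ p)
  mem_closure : ∀ p, ψ p ∈ closure Ω
  boundary_mem_frontier : ∀ p ∈ (𝓡∂ (k + 1)).boundary M, ψ p ∈ frontier Ω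
  conormal_eq : ∀ p ∈ (𝓡∂ (k + 1)).boundary M, IsOutwardConormal k ψ p (N (ψ p))

end

/-!
The formula is the divergence theorem on the hypersurface, applied to the tangent field
`X = φ ∇F + (1 - F) ∇φ`, where `∇` is the surface gradient. Its divergence is
`φ ΔF + (1 - F) Δφ`, since the two terms `⟪∇φ, ∇F⟫` produced by the product rule
(`surfaceDivergence_smul_surfaceGradient`) cancel. On the boundary `F = 1`, so the flux density
is `φ ⟪∇F, ν⟫ = φ dF(ν)`, and the free-boundary condition `ν = ∇F / |∇F|` turns this into
`φ |∇F|`.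

The divergence theorem `integral_surfaceDivergence` is proved for the Riemannian measures built
from a partition of unity `(ρ_c)`. In a chart, with `X = dψ ξ`, one has
`√det g · div X = ∑ᵢ ∂ᵢ(√det g · ξⁱ)` (`trace_fderiv_volDensity_smul`), which rests on the symmetry
of `D²ψ` and on the formula `fderiv_volDensity` for the derivative of `√det (A†A)`. Hence for a
field supported in one chart domain the statement reduces to the divergence theorem on the half
space (`integral_divergence_halfSpace`), the linear algebra of `flux_through_face` identifying
`-√det g · ξ⁰` with `√det h · ⟪X, ν⟫`; that the conormal has the expected form in every chart is
`IsOutwardConormal.chart`. The general field is the sum of the fields `ρ_c X`. The area integral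
of `div (ρ_c X)` can be computed in the chart around `c` alone because the Riemannian integral
does not depend on the chart (`integral_chart_eq_integral_chart`, by the change of variables
formula), whereas the boundary measure is by definition the sum of the contributions
of the `ρ_c`, so that no change of variables is needed there.
-/

noncomputable section

local notation "𝔼" m:max => EuclideanSpace ℝ (Fin m)

/-! ### Linear algebra of injective linear maps -/

section LinearAlgebra

variable {m n : ℕ} {A : 𝔼 m →L[ℝ] 𝔼 n}

theorem inner_gramOp_left (A : 𝔼 m →L[ℝ] 𝔼 n) (u v : 𝔼 m) :
    ⟪gramOp A u, v⟫_ℝ = ⟪A u, A v⟫_ℝ := by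
  simp [gramOp, ContinuousLinearMap.adjoint_inner_left]

theorem gramOp_isInvertible (hA : Function.Injective A) : (gramOp A).IsInvertible := by
  have hinj : Function.Injective (gramOp A) := by
    rw [injective_iff_map_eq_zero]
    intro u hu
    have h := inner_gramOp_left A u u
    rw [hu, inner_zero_left] at h
    exact (injective_iff_map_eq_zero A).1 hA u (inner_self_eq_zero.1 h.symm)
  exact ⟨(LinearEquiv.ofInjectiveEndo (gramOp A : 𝔼 m →ₗ[ℝ] 𝔼 m) hinj).toContinuousLinearEquiv,
    by ext u; rfl⟩

theorem tangentialPart_comp_self (hA : Function.Injective A) :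
    tangentialPart A ∘L A = ContinuousLinearMap.id ℝ (𝔼 m) := by
  rw [tangentialPart, ContinuousLinearMap.comp_assoc]
  exact (gramOp_isInvertible hA).inverse_comp_self

theorem tangentialPart_apply_self (hA : Function.Injective A) (u : 𝔼 m) :
    tangentialPart A (A u) = u :=
  congrArg (fun B : 𝔼 m →L[ℝ] 𝔼 m => B u) (tangentialPart_comp_self hA)

theorem gramOp_comp (A : 𝔼 m →L[ℝ] 𝔼 n) {l : ℕ} (L : 𝔼 l →L[ℝ] 𝔼 m) :
    gramOp (A ∘L L) = ContinuousLinearMap.adjoint L ∘L gramOp A ∘L L := by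
  simp only [gramOp, ContinuousLinearMap.adjoint_comp, ContinuousLinearMap.comp_assoc]

theorem adjoint_isInvertible {L : 𝔼 m →L[ℝ] 𝔼 n} (hL : L.IsInvertible) :
    (ContinuousLinearMap.adjoint L).IsInvertible := by
  refine .of_inverse (g := ContinuousLinearMap.adjoint L.inverse) ?_ ?_
  · rw [← ContinuousLinearMap.adjoint_comp, hL.inverse_comp_self, ContinuousLinearMap.adjoint_id]
  · rw [← ContinuousLinearMap.adjoint_comp, hL.self_comp_inverse, ContinuousLinearMap.adjoint_id]

theorem tangentialPart_comp {L : 𝔼 m →L[ℝ] 𝔼 m} (hL : L.IsInvertible) :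
    tangentialPart (A ∘L L) = L.inverse ∘L tangentialPart A := by
  have hL' := adjoint_isInvertible hL
  rw [tangentialPart, gramOp_comp, hL'.inverse_comp_of_left, hL.inverse_comp_of_right,
    ContinuousLinearMap.adjoint_comp, tangentialPart]
  ext1 v
  simp only [ContinuousLinearMap.comp_apply]
  rw [hL'.inverse_apply_self]

theorem toLinearMap_adjoint (L : 𝔼 m →L[ℝ] 𝔼 m) :
    LinearMap.adjoint (L : 𝔼 m →ₗ[ℝ] 𝔼 m) =
      (ContinuousLinearMap.adjoint L : 𝔼 m →L[ℝ] 𝔼 m) := rfl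

theorem det_adjoint (L : 𝔼 m →L[ℝ] 𝔼 m) :
    (ContinuousLinearMap.adjoint L).det = L.det := by
  have := LinearMap.toMatrix_adjoint (EuclideanSpace.basisFun (Fin m) ℝ)
    (EuclideanSpace.basisFun (Fin m) ℝ) (L : 𝔼 m →ₗ[ℝ] 𝔼 m)
  have h2 := congrArg Matrix.det this
  rw [Matrix.det_conjTranspose, LinearMap.det_toMatrix, LinearMap.det_toMatrix,
    toLinearMap_adjoint] at h2
  simpa using h2

theorem trace_adjoint (L : 𝔼 m →L[ℝ] 𝔼 m) :
    LinearMap.trace ℝ (𝔼 m) (ContinuousLinearMap.adjoint L : 𝔼 m →L[ℝ] 𝔼 m)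
      = LinearMap.trace ℝ (𝔼 m) (L : 𝔼 m →ₗ[ℝ] 𝔼 m) := by
  have := LinearMap.toMatrix_adjoint (EuclideanSpace.basisFun (Fin m) ℝ)
    (EuclideanSpace.basisFun (Fin m) ℝ) (L : 𝔼 m →ₗ[ℝ] 𝔼 m)
  have h2 := congrArg Matrix.trace this
  rw [Matrix.trace_conjTranspose, ← LinearMap.trace_eq_matrix_trace,
    ← LinearMap.trace_eq_matrix_trace, toLinearMap_adjoint] at h2
  simpa using h2

theorem volDensity_comp (A : 𝔼 m →L[ℝ] 𝔼 n) (L : 𝔼 m →L[ℝ] 𝔼 m) :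
    volDensity (A ∘L L) = |L.det| * volDensity A := by
  have h : (gramOp (A ∘L L)).det = L.det ^ 2 * (gramOp A).det := by
    rw [gramOp_comp]
    have : (ContinuousLinearMap.adjoint L ∘L gramOp A ∘L L).det
        = (ContinuousLinearMap.adjoint L).det * ((gramOp A).det * L.det) := by
      simp only [ContinuousLinearMap.det, ContinuousLinearMap.toLinearMap_comp, LinearMap.det_comp]
    rw [this, det_adjoint]; ring
  rw [volDensity, h, Real.sqrt_mul (sq_nonneg _), Real.sqrt_sq_eq_abs, volDensity]

theorem volDensity_nonneg (A : 𝔼 m →L[ℝ] 𝔼 n) : 0 ≤ volDensity A := Real.sqrt_nonneg _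

theorem det_gramOp_nonneg (A : 𝔼 m →L[ℝ] 𝔼 n) : 0 ≤ (gramOp A).det := by
  let b := EuclideanSpace.basisFun (Fin m) ℝ
  let b' := EuclideanSpace.basisFun (Fin n) ℝ
  have h1 : LinearMap.toMatrix b.toBasis b.toBasis (gramOp A : 𝔼 m →ₗ[ℝ] 𝔼 m) =
      (LinearMap.toMatrix b.toBasis b'.toBasis (A : 𝔼 m →ₗ[ℝ] 𝔼 n)).conjTranspose *
        LinearMap.toMatrix b.toBasis b'.toBasis (A : 𝔼 m →ₗ[ℝ] 𝔼 n) := by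
    rw [← LinearMap.toMatrix_adjoint, ← LinearMap.toMatrix_comp]
    rfl
  have h2 := (Matrix.posSemidef_conjTranspose_mul_self
    (LinearMap.toMatrix b.toBasis b'.toBasis (A : 𝔼 m →ₗ[ℝ] 𝔼 n))).det_nonneg
  rw [← h1, LinearMap.det_toMatrix] at h2
  exact h2

theorem det_gramOp_pos (hA : Function.Injective A) : 0 < (gramOp A).det := by
  refine lt_of_le_of_ne (det_gramOp_nonneg A) (Ne.symm ?_)
  obtain ⟨e, he⟩ := gramOp_isInvertible hA
  rw [← he]
  exact (LinearEquiv.isUnit_det' e.toLinearEquiv).ne_zero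

/-- For injective `A`, the image under `A` of the vector dual to the covector `α` for the metric
pulled back by `A`. -/
def gradientVec (A : 𝔼 m →L[ℝ] 𝔼 n) (α : 𝔼 m →L[ℝ] ℝ) : 𝔼 n :=
  A ((gramOp A).inverse ((InnerProductSpace.toDual ℝ (𝔼 m)).symm α))

theorem inner_gradientVec (hA : Function.Injective A) (α : 𝔼 m →L[ℝ] ℝ) (u : 𝔼 m) :
    ⟪gradientVec A α, A u⟫_ℝ = α u := by
  rw [gradientVec, ← inner_gramOp_left, (gramOp_isInvertible hA).self_apply_inverse,
    InnerProductSpace.toDual_symm_apply]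

/-- The gradient vector depends only on the image of `A` and the covector along it, so it does
not change under a change of basis of the source. -/
theorem gradientVec_comp (hA : Function.Injective A) (α : 𝔼 m →L[ℝ] ℝ) {L : 𝔼 m →L[ℝ] 𝔼 m}
    (hL : L.IsInvertible) : gradientVec (A ∘L L) (α ∘L L) = gradientVec A α := by
  have hAL : Function.Injective (A ∘L L) := hA.comp hL.injective
  obtain ⟨w, hw⟩ : ∃ w, gradientVec (A ∘L L) (α ∘L L) - gradientVec A α = A w :=
    ⟨_, by rw [gradientVec, gradientVec, ContinuousLinearMap.comp_apply, ← map_sub]⟩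
  rw [← sub_eq_zero, ← inner_self_eq_zero (𝕜 := ℝ)]
  nth_rw 2 [hw]
  rw [inner_sub_left, inner_gradientVec hA]
  obtain ⟨z, rfl⟩ := hL.surjective w
  rw [← ContinuousLinearMap.comp_apply A L z, inner_gradientVec hAL]
  simp

theorem trace_conj_inverse {L : 𝔼 m →L[ℝ] 𝔼 m} (hL : L.IsInvertible) (B : 𝔼 m →L[ℝ] 𝔼 m) :
    LinearMap.trace ℝ (𝔼 m) (L.inverse ∘L B ∘L L : 𝔼 m →L[ℝ] 𝔼 m) =
      LinearMap.trace ℝ (𝔼 m) (B : 𝔼 m →ₗ[ℝ] 𝔼 m) := by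
  have h : ((L.inverse ∘L B ∘L L : 𝔼 m →L[ℝ] 𝔼 m) : 𝔼 m →ₗ[ℝ] 𝔼 m) =
      (L.inverse : 𝔼 m →ₗ[ℝ] 𝔼 m) * ((B : 𝔼 m →ₗ[ℝ] 𝔼 m) * (L : 𝔼 m →ₗ[ℝ] 𝔼 m)) := rfl
  rw [h, LinearMap.trace_mul_comm, mul_assoc]
  have h2 : (L : 𝔼 m →ₗ[ℝ] 𝔼 m) * (L.inverse : 𝔼 m →ₗ[ℝ] 𝔼 m) = 1 := by
    ext1 u; exact hL.self_apply_inverse u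
  rw [h2, mul_one]

end LinearAlgebra

/-! ### Smoothness of the linear algebra operations and the derivative of the volume density -/

section Smoothness

variable {m n : ℕ} {A : 𝔼 m →L[ℝ] 𝔼 n}

theorem contDiff_adjoint :
    ContDiff ℝ ∞ (fun A : 𝔼 m →L[ℝ] 𝔼 n => ContinuousLinearMap.adjoint A) := by
  have h : IsBoundedLinearMap ℝ (fun A : 𝔼 m →L[ℝ] 𝔼 n => ContinuousLinearMap.adjoint A) :=
    IsLinearMap.with_bound ⟨map_add _, fun c x => by simp⟩ 1 fun A => by simp
  exact h.contDiff

theorem contDiff_gramOp : ContDiff ℝ ∞ (gramOp : (𝔼 m →L[ℝ] 𝔼 n) → (𝔼 m →L[ℝ] 𝔼 m)) :=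
  contDiff_adjoint.clm_comp contDiff_id

theorem contDiff_continuousLinearMap_det :
    ContDiff ℝ ∞ (fun G : 𝔼 m →L[ℝ] 𝔼 m => G.det) := by
  let b := (EuclideanSpace.basisFun (Fin m) ℝ).toBasis
  have h : (fun G : 𝔼 m →L[ℝ] 𝔼 m => G.det) = fun G : 𝔼 m →L[ℝ] 𝔼 m =>
      ∑ σ : Equiv.Perm (Fin m), Equiv.Perm.sign σ •
        ∏ i, LinearMap.toMatrix b b (G : 𝔼 m →ₗ[ℝ] 𝔼 m) (σ i) i := by
    ext G
    rw [ContinuousLinearMap.det, ← LinearMap.det_toMatrix b, Matrix.det_apply]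
  rw [h]
  refine ContDiff.sum fun σ _ => ContDiff.const_smul _ (contDiff_prod fun i _ => ?_)
  let l : (𝔼 m →L[ℝ] 𝔼 m) →ₗ[ℝ] ℝ :=
    { toFun := fun G => LinearMap.toMatrix b b (G : 𝔼 m →ₗ[ℝ] 𝔼 m) (σ i) i
      map_add' := fun G K => by simp
      map_smul' := fun c G => by simp }
  exact (LinearMap.toContinuousLinearMap l).contDiff

theorem contDiffAt_volDensity (hA : Function.Injective A) : ContDiffAt ℝ ∞ volDensity A :=
  ((contDiff_continuousLinearMap_det.comp contDiff_gramOp).contDiffAt).sqrt (det_gramOp_pos hA).ne'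

theorem contDiffAt_gramOp_inverse (hA : Function.Injective A) :
    ContDiffAt ℝ ∞ (fun B : 𝔼 m →L[ℝ] 𝔼 n => (gramOp B).inverse) A :=
  ContDiffAt.comp A (gramOp_isInvertible hA).contDiffAt_map_inverse contDiff_gramOp.contDiffAt

theorem contDiffAt_tangentialPart (hA : Function.Injective A) : ContDiffAt ℝ ∞ tangentialPart A :=
  (contDiffAt_gramOp_inverse hA).clm_comp contDiff_adjoint.contDiffAt

theorem hasDerivAt_det_add_smul {G : 𝔼 m →L[ℝ] 𝔼 m} (hG : G.IsInvertible) (B : 𝔼 m →L[ℝ] 𝔼 m) :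
    HasDerivAt (fun t : ℝ => (G + t • B).det)
      (G.det * LinearMap.trace ℝ (𝔼 m) (G.inverse ∘L B : 𝔼 m →L[ℝ] 𝔼 m)) 0 := by
  let b := (EuclideanSpace.basisFun (Fin m) ℝ).toBasis
  let M := LinearMap.toMatrix b b ((G.inverse ∘L B : 𝔼 m →L[ℝ] 𝔼 m) : 𝔼 m →ₗ[ℝ] 𝔼 m)
  have h : ∀ t : ℝ, (G + t • B).det = G.det * (1 + t • M).det := by
    intro t
    have h1 : G + t • B = G ∘L (ContinuousLinearMap.id ℝ (𝔼 m) + t • (G.inverse ∘L B)) := by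
      ext1 u
      simp [hG.self_apply_inverse]
    have h2 : (G ∘L (ContinuousLinearMap.id ℝ (𝔼 m) + t • (G.inverse ∘L B))).det
        = G.det * (ContinuousLinearMap.id ℝ (𝔼 m) + t • (G.inverse ∘L B)).det := by
      simp only [ContinuousLinearMap.det, ContinuousLinearMap.toLinearMap_comp, LinearMap.det_comp]
    rw [h1, h2]
    congr 1
    rw [ContinuousLinearMap.det, ← LinearMap.det_toMatrix b]
    congr 1
    have h3 : ((ContinuousLinearMap.id ℝ (𝔼 m) + t • (G.inverse ∘L B) : 𝔼 m →L[ℝ] 𝔼 m) :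
        𝔼 m →ₗ[ℝ] 𝔼 m) = LinearMap.id +
          t • ((G.inverse ∘L B : 𝔼 m →L[ℝ] 𝔼 m) : 𝔼 m →ₗ[ℝ] 𝔼 m) := rfl
    rw [h3, map_add, map_smul, LinearMap.toMatrix_id]
  rw [funext h]
  rw [funext fun t : ℝ => congrArg (G.det * ·) (Matrix.det_one_add_smul t M)]
  refine HasDerivAt.const_mul _ ?_
  have hT : LinearMap.trace ℝ (𝔼 m) (G.inverse ∘L B : 𝔼 m →L[ℝ] 𝔼 m) = M.trace :=
    LinearMap.trace_eq_matrix_trace ℝ b _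
  rw [hT]
  have hp := Polynomial.hasDerivAt
    ((1 : Matrix (Fin m) (Fin m) (Polynomial ℝ)) +
      (Polynomial.X : Polynomial ℝ) • M.map Polynomial.C).det.divX.divX 0
  have := (((hasDerivAt_id (0 : ℝ)).const_mul M.trace).const_add 1).add
    (hp.mul ((hasDerivAt_id (0 : ℝ)).pow 2))
  refine this.congr_deriv ?_
  simp

/-- Jacobi's formula for the derivative of the determinant. -/
theorem fderiv_det {G : 𝔼 m →L[ℝ] 𝔼 m} (hG : G.IsInvertible) (B : 𝔼 m →L[ℝ] 𝔼 m) :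
    fderiv ℝ (fun K : 𝔼 m →L[ℝ] 𝔼 m => K.det) G B =
      G.det * LinearMap.trace ℝ (𝔼 m) (G.inverse ∘L B : 𝔼 m →L[ℝ] 𝔼 m) := by
  have hd : DifferentiableAt ℝ (fun K : 𝔼 m →L[ℝ] 𝔼 m => K.det) G :=
    (contDiff_continuousLinearMap_det.differentiable (by simp)) G
  rw [← hd.lineDeriv_eq_fderiv]
  exact (hasDerivAt_det_add_smul hG B).deriv

/-- The logarithmic derivative of the volume density of `A` in the direction `B` is the trace of
the tangential part of `B`. -/
theorem fderiv_volDensity (hA : Function.Injective A) (B : 𝔼 m →L[ℝ] 𝔼 n) :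
    fderiv ℝ volDensity A B =
      volDensity A * LinearMap.trace ℝ (𝔼 m) (tangentialPart A ∘L B : 𝔼 m →L[ℝ] 𝔼 m) := by
  have hG := gramOp_isInvertible hA
  have hadj : IsBoundedLinearMap ℝ (fun A : 𝔼 m →L[ℝ] 𝔼 n => ContinuousLinearMap.adjoint A) :=
    IsLinearMap.with_bound ⟨map_add _, fun c x => by simp⟩ 1 fun A => by simp
  have hg : HasFDerivAt (gramOp : (𝔼 m →L[ℝ] 𝔼 n) → (𝔼 m →L[ℝ] 𝔼 m)) _ A :=
    HasFDerivAt.clm_comp hadj.hasFDerivAt (hasFDerivAt_id A)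
  have hdet : HasFDerivAt (fun K : 𝔼 m →L[ℝ] 𝔼 m => K.det) _ (gramOp A) :=
    (contDiff_continuousLinearMap_det.differentiable (by simp) (gramOp A)).hasFDerivAt
  have hv := ((hdet.comp A hg).sqrt (det_gramOp_pos hA).ne').fderiv
  have hv' : fderiv ℝ volDensity A = _ := hv
  rw [hv']
  -- `g⁻¹ B† A` and its adjoint `A⁺ B` have the same trace.
  have htr : LinearMap.trace ℝ (𝔼 m)
      ((gramOp A).inverse ∘L (ContinuousLinearMap.adjoint B ∘L A) : 𝔼 m →L[ℝ] 𝔼 m) =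
      LinearMap.trace ℝ (𝔼 m) (tangentialPart A ∘L B : 𝔼 m →L[ℝ] 𝔼 m) := by
    have hsa : ContinuousLinearMap.adjoint (gramOp A).inverse = (gramOp A).inverse := by
      have hgs : ContinuousLinearMap.adjoint (gramOp A) = gramOp A := by
        rw [gramOp, ContinuousLinearMap.adjoint_comp, ContinuousLinearMap.adjoint_adjoint]
      have h1 : ContinuousLinearMap.adjoint (gramOp A).inverse ∘L gramOp A =
          ContinuousLinearMap.id ℝ (𝔼 m) := by
        nth_rw 2 [← hgs]
        rw [← ContinuousLinearMap.adjoint_comp, hG.self_comp_inverse,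
          ContinuousLinearMap.adjoint_id]
      calc ContinuousLinearMap.adjoint (gramOp A).inverse
          = ContinuousLinearMap.adjoint (gramOp A).inverse ∘L
            (gramOp A ∘L (gramOp A).inverse) := by rw [hG.self_comp_inverse]; rfl
        _ = _ := by rw [← ContinuousLinearMap.comp_assoc, h1]; rfl
    rw [← trace_adjoint (tangentialPart A ∘L B), ContinuousLinearMap.adjoint_comp, tangentialPart,
      ContinuousLinearMap.adjoint_comp, ContinuousLinearMap.adjoint_adjoint, hsa]
    exact (LinearMap.trace_mul_comm ℝ
      ((gramOp A).inverse : 𝔼 m →ₗ[ℝ] 𝔼 m)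
      ((ContinuousLinearMap.adjoint B ∘L A : 𝔼 m →L[ℝ] 𝔼 m) : 𝔼 m →ₗ[ℝ] 𝔼 m))
  have hs : ∀ C D : 𝔼 m →L[ℝ] 𝔼 m, LinearMap.trace ℝ (𝔼 m)
      ((gramOp A).inverse ∘L (C + D) : 𝔼 m →L[ℝ] 𝔼 m) =
      LinearMap.trace ℝ (𝔼 m) ((gramOp A).inverse ∘L C : 𝔼 m →L[ℝ] 𝔼 m) +
      LinearMap.trace ℝ (𝔼 m) ((gramOp A).inverse ∘L D : 𝔼 m →L[ℝ] 𝔼 m) := fun C D => by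
    rw [ContinuousLinearMap.comp_add, ContinuousLinearMap.toLinearMap_add, map_add]
  simp only [smul_apply, ContinuousLinearMap.comp_apply, fderiv_det hG,
    add_apply, ContinuousLinearMap.compL_apply,
    ContinuousLinearMap.flip_apply, ContinuousLinearMap.id_apply, smul_eq_mul]
  have hcoe : (hadj.toContinuousLinearMap) B = ContinuousLinearMap.adjoint B := rfl
  rw [hcoe, hs, htr]
  have hAB : (gramOp A).inverse ∘L (ContinuousLinearMap.adjoint A ∘L B) =
    tangentialPart A ∘L B := rfl
  rw [hAB]
  have hpos := Real.sqrt_pos.2 (det_gramOp_pos hA)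
  have hsq : (gramOp A).det = √(gramOp A).det * √(gramOp A).det :=
    (Real.mul_self_sqrt (det_gramOp_nonneg A)).symm
  rw [volDensity]
  simp only [Function.comp_apply]
  field_simp
  rw [sq, ← hsq]; ring

end Smoothness

/-! ### The volume density of the face of a half space -/

section Face

variable {k n : ℕ}

@[simp]
theorem faceInclusion_zero (z : 𝔼 k) : faceInclusion k z 0 = 0 := rfl

@[simp]
theorem faceInclusion_succ (z : 𝔼 k) (i : Fin k) : faceInclusion k z i.succ = z i := rfl

theorem det_gramOp_eq {m n : ℕ} (A : 𝔼 m →L[ℝ] 𝔼 n) :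
    (gramOp A).det = (Matrix.of fun i j : Fin m =>
      ⟪A (EuclideanSpace.single i 1), A (EuclideanSpace.single j 1)⟫_ℝ).det := by
  let b := (EuclideanSpace.basisFun (Fin m) ℝ).toBasis
  rw [ContinuousLinearMap.det, ← LinearMap.det_toMatrix b]
  congr 1
  ext i j
  rw [LinearMap.toMatrix_apply, Matrix.of_apply, real_inner_comm, ← inner_gramOp_left,
    EuclideanSpace.inner_single_right]
  simp [b]

theorem faceInclusion_single (i : Fin k) :
    faceInclusion k (EuclideanSpace.single i 1) = EuclideanSpace.single i.succ 1 := by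
  ext j
  refine Fin.cases ?_ (fun j => ?_) j
  · simp
  · simp

/-- If `A w` is a unit vector orthogonal to the image of the hyperplane `u₀ = 0`, then `-w₀` is
the ratio of the volume densities of the hyperplane and of the whole space. -/
theorem volDensity_comp_faceInclusion (A : 𝔼 (k + 1) →L[ℝ] 𝔼 n) {w : 𝔼 (k + 1)}
    (hw : w 0 < 0) (hnorm : ‖A w‖ = 1)
    (horth : ∀ u : 𝔼 (k + 1), u 0 = 0 → ⟪A u, A w⟫_ℝ = 0) :
    volDensity (A ∘L faceInclusion k) = -w 0 * volDensity A := by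
  -- `P` replaces the basis vector `e₀` by `w` and keeps the remaining ones.
  let P : 𝔼 (k + 1) →L[ℝ] 𝔼 (k + 1) := ContinuousLinearMap.id ℝ _ +
    (EuclideanSpace.proj (0 : Fin (k + 1)) : 𝔼 (k + 1) →L[ℝ] ℝ).smulRight
      (w - EuclideanSpace.single 0 1)
  have hP0 : P (EuclideanSpace.single 0 1) = w := by
    ext i; simp [P]
  have hPs : ∀ i : Fin k, P (EuclideanSpace.single i.succ 1) = EuclideanSpace.single i.succ 1 := by
    intro i; ext j; simp [P]
  have hdetP : P.det = w 0 := by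
    let b := (EuclideanSpace.basisFun (Fin (k + 1)) ℝ).toBasis
    rw [ContinuousLinearMap.det, ← LinearMap.det_toMatrix b, Matrix.det_succ_row_zero,
      Fin.sum_univ_succ]
    have h0 : ∀ j : Fin k, LinearMap.toMatrix b b (P : 𝔼 (k + 1) →ₗ[ℝ] 𝔼 (k + 1)) 0 j.succ = 0 := by
      intro j
      rw [LinearMap.toMatrix_apply]
      simp [b, hPs]
    have h1 : (LinearMap.toMatrix b b (P : 𝔼 (k + 1) →ₗ[ℝ] 𝔼 (k + 1))).submatrix Fin.succ
        (Fin.succAbove 0) = 1 := by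
      ext i j
      rw [Matrix.submatrix_apply, LinearMap.toMatrix_apply]
      simp [b, hPs, Matrix.one_apply]
    rw [h1]
    simp only [h0]
    rw [LinearMap.toMatrix_apply]
    simp [b, hP0]
  have hgram : (gramOp (A ∘L P)).det = (gramOp (A ∘L faceInclusion k)).det := by
    rw [det_gramOp_eq, det_gramOp_eq, Matrix.det_succ_row_zero, Fin.sum_univ_succ]
    have h00 : ⟪A w, A w⟫_ℝ = 1 := by rw [real_inner_self_eq_norm_sq, hnorm]; norm_num
    have h0 : ∀ j : Fin k, ⟪A w, A (EuclideanSpace.single j.succ 1)⟫_ℝ = 0 := fun j => by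
      rw [real_inner_comm]; exact horth _ (by simp)
    simp only [Matrix.of_apply, ContinuousLinearMap.comp_apply, hP0, hPs, h0, h00]
    simp only [Fin.val_zero, pow_zero, mul_one, one_mul, mul_zero, zero_mul, Finset.sum_const_zero,
      add_zero]
    congr 1
    ext i j
    simp [hPs, faceInclusion_single]
  have h := volDensity_comp A P
  rw [hdetP, abs_of_neg hw] at h
  rw [← h, volDensity, volDensity, hgram]

/-- The component `ξ₀` of `A ξ` computes the flux through the face. -/
theorem flux_through_face (A : 𝔼 (k + 1) →L[ℝ] 𝔼 n) {w : 𝔼 (k + 1)}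
    (hw : w 0 < 0) (hnorm : ‖A w‖ = 1)
    (horth : ∀ u : 𝔼 (k + 1), u 0 = 0 → ⟪A u, A w⟫_ℝ = 0) (ξ : 𝔼 (k + 1)) :
    volDensity (A ∘L faceInclusion k) * ⟪A ξ, A w⟫_ℝ = -(volDensity A * ξ 0) := by
  have h : ⟪A ξ, A w⟫_ℝ = ξ 0 / w 0 := by
    have h1 := horth (ξ - (ξ 0 / w 0) • w) (by simp [div_mul_cancel₀ _ hw.ne])
    rw [map_sub, map_smul, inner_sub_left, real_inner_smul_left, real_inner_self_eq_norm_sq,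
      hnorm] at h1
    linarith
  rw [volDensity_comp_faceInclusion A hw hnorm horth, h]
  field_simp [hw.ne]

end Face

/-! ### The divergence theorem on the half space -/

section HalfSpace

variable {k : ℕ}

theorem isClosed_halfSpace : IsClosed {y : 𝔼 (k + 1) | 0 ≤ y 0} :=
  isClosed_le continuous_const (EuclideanSpace.proj (0 : Fin (k + 1))).continuous

/-- The divergence theorem for a vector field of compact support on the half space
`{y | 0 ≤ y₀}`: the interior integral of the divergence is the flux through the face `y₀ = 0`. -/
theorem integral_divergence_halfSpace {η : 𝔼 (k + 1) → 𝔼 (k + 1)} {D : 𝔼 (k + 1) → ℝ}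
    {K : Set (𝔼 (k + 1))} (hK : IsCompact K) (h0 : ∀ y, y ∉ K → η y = 0)
    (hη : ContinuousOn η {y | 0 ≤ y 0}) (hD : ContinuousOn D {y | 0 ≤ y 0})
    (hD0 : ∀ y, y ∉ K → D y = 0)
    (hd : ∀ y : 𝔼 (k + 1), 0 < y 0 → DifferentiableAt ℝ η y ∧
      LinearMap.trace ℝ (𝔼 (k + 1)) (fderiv ℝ η y : 𝔼 (k + 1) →ₗ[ℝ] 𝔼 (k + 1)) = D y) :
    ∫ y in {y : 𝔼 (k + 1) | 0 ≤ y 0}, D y = -∫ z : 𝔼 k, η (faceInclusion k z) 0 := by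
  -- Enclose the support in the box `[0, R] × [-R, R]ᵏ`; of its faces only `y₀ = 0` meets `K`.
  obtain ⟨R, hR0, hR⟩ : ∃ R : ℝ, 0 < R ∧ ∀ y ∈ K, ∀ i, |y i| < R := by
    obtain ⟨R, hR⟩ := hK.isBounded.exists_norm_le
    refine ⟨max R 0 + 1, by positivity, fun y hy i => ?_⟩
    have h1 := PiLp.norm_apply_le y i
    rw [Real.norm_eq_abs] at h1
    have := hR y hy
    have := le_max_left R 0
    linarith
  let e : 𝔼 (k + 1) ≃L[ℝ] (Fin (k + 1) → ℝ) := EuclideanSpace.equiv (Fin (k + 1)) ℝ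
  let a : Fin (k + 1) → ℝ := Fin.cons 0 fun _ => -R
  let b : Fin (k + 1) → ℝ := fun _ => R
  have hle : a ≤ b := by
    intro i
    refine Fin.cases ?_ (fun j => ?_) i
    · simpa [a, b] using hR0.le
    · simp only [a, b, Fin.cons_succ]; linarith
  have hmaps : MapsTo e.symm (Icc a b) {y : 𝔼 (k + 1) | 0 ≤ y 0} := fun x hx => by
    have := hx.1 0
    simpa [a, e] using this
  have hout : ∀ x : Fin (k + 1) → ℝ, ∀ i, |x i| = R → e.symm x ∉ K := fun x i hi hx =>
    (hR _ hx i).ne hi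
  have main := integral_divergence_of_hasFDerivAt_off_countable a b hle
    (fun x => e (η (e.symm x)))
    (fun x => (e : 𝔼 (k + 1) →L[ℝ] _) ∘L fderiv ℝ η (e.symm x) ∘L
      (e.symm : (Fin (k + 1) → ℝ) →L[ℝ] 𝔼 (k + 1)))
    ∅ countable_empty
    (e.continuous.comp_continuousOn (hη.comp e.symm.continuous.continuousOn hmaps))
    (fun x hx => by
      have hx0 : 0 < (e.symm x) 0 := by
        have := (hx.1 0 (mem_univ _)).1
        simpa [a, e] using this
      exact e.hasFDerivAt.comp x
        ((hd _ hx0).1.hasFDerivAt.comp x e.symm.hasFDerivAt))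
  have htrace : ∀ B : 𝔼 (k + 1) →L[ℝ] 𝔼 (k + 1),
      ∑ i, ((e : 𝔼 (k + 1) →L[ℝ] (Fin (k + 1) → ℝ)) ∘L B ∘L
        (e.symm : (Fin (k + 1) → ℝ) →L[ℝ] 𝔼 (k + 1))) (Pi.single i 1) i =
      LinearMap.trace ℝ (𝔼 (k + 1)) (B : 𝔼 (k + 1) →ₗ[ℝ] 𝔼 (k + 1)) := by
    intro B
    rw [LinearMap.trace_eq_matrix_trace ℝ (EuclideanSpace.basisFun (Fin (k + 1)) ℝ).toBasis,
      Matrix.trace]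
    refine Finset.sum_congr rfl fun i _ => ?_
    rw [Matrix.diag_apply, LinearMap.toMatrix_apply]
    simp [e]
  -- Off the null set `x₀ = 0` the sum of partial derivatives is `D`.
  have hae : ∀ᵐ x : Fin (k + 1) → ℝ, x 0 ≠ 0 := by
    rw [ae_iff]
    have := Measure.pi_hyperplane (fun _ : Fin (k + 1) => (volume : Measure ℝ)) 0 (0 : ℝ)
    simpa [volume_pi] using this
  have hcongr : ∀ᵐ x : Fin (k + 1) → ℝ, x ∈ Icc a b →
      ∑ i, ((e : 𝔼 (k + 1) →L[ℝ] (Fin (k + 1) → ℝ)) ∘L fderiv ℝ η (e.symm x) ∘L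
        (e.symm : (Fin (k + 1) → ℝ) →L[ℝ] 𝔼 (k + 1))) (Pi.single i 1) i = D (e.symm x) := by
    filter_upwards [hae] with x hx hxI
    rw [htrace]
    refine (hd _ (lt_of_le_of_ne (hmaps hxI) ?_)).2
    exact Ne.symm hx
  have hDI : IntegrableOn (fun x => D (e.symm x)) (Icc a b) :=
    (hD.comp e.symm.continuous.continuousOn hmaps).integrableOn_compact isCompact_Icc
  have main2 := main (hDI.congr_fun_ae (by
    rw [Filter.EventuallyEq, ae_restrict_iff' measurableSet_Icc]
    filter_upwards [hcongr] with x hx hxI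
    exact (hx hxI).symm))
  rw [setIntegral_congr_ae measurableSet_Icc hcongr] at main2
  have hvol : MeasurePreserving (e.symm : (Fin (k + 1) → ℝ) → 𝔼 (k + 1)) volume volume :=
    PiLp.volume_preserving_toLp (Fin (k + 1))
  have hemb : MeasurableEmbedding (e.symm : (Fin (k + 1) → ℝ) → 𝔼 (k + 1)) :=
    e.symm.toHomeomorph.measurableEmbedding
  have hLHS : ∫ y in {y : 𝔼 (k + 1) | 0 ≤ y 0}, D y = ∫ x in Icc a b, D (e.symm x) := by
    rw [← hvol.setIntegral_preimage_emb hemb]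
    refine setIntegral_eq_of_subset_of_forall_sdiff_eq_zero
      (isClosed_halfSpace.preimage e.symm.continuous).measurableSet hmaps fun x hx => ?_
    refine hD0 _ fun hxK => hx.2 ?_
    have h1 := hR _ hxK
    refine ⟨fun i => ?_, fun i => (abs_lt.1 (h1 i)).2.le⟩
    refine Fin.cases ?_ (fun j => ?_) i
    · exact hx.1
    · exact (abs_lt.1 (h1 j.succ)).1.le
  rw [hLHS, main2, Fin.sum_univ_succ]
  have hz : ∀ i : Fin (k + 1), ∀ (r : ℝ) (x : Fin k → ℝ), |r| = R →
      e (η (e.symm (i.insertNth r x))) i = 0 := fun i r x hr => by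
    rw [h0 _ (hout _ i (by simpa using hr))]; simp
  have hRabs : |R| = R := abs_of_pos hR0
  have hRabs' : |-R| = R := by rw [abs_neg, hRabs]
  have hsucc : ∀ j : Fin k, a j.succ = -R := fun j => rfl
  have hb : ∀ i, b i = R := fun i => rfl
  simp only [hb, hsucc, hz _ _ _ hRabs, hz _ _ _ hRabs', integral_zero, sub_self,
    Finset.sum_const_zero, add_zero, zero_sub]
  congr 1
  have hvol' : MeasurePreserving
      ((EuclideanSpace.equiv (Fin k) ℝ).symm : (Fin k → ℝ) → 𝔼 k) volume volume :=
    PiLp.volume_preserving_toLp (Fin k)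
  rw [← hvol'.integral_comp
    (EuclideanSpace.equiv (Fin k) ℝ).symm.toHomeomorph.measurableEmbedding]
  have hface : ∀ x : Fin k → ℝ, e.symm ((0 : Fin (k + 1)).insertNth (a 0) x) =
      faceInclusion k ((EuclideanSpace.equiv (Fin k) ℝ).symm x) := by
    intro x
    ext i
    refine Fin.cases ?_ (fun j => ?_) i
    · simp [e, a]
    · simp [e]
  refine (setIntegral_congr_fun (g := fun x => η (faceInclusion k
    ((EuclideanSpace.equiv (Fin k) ℝ).symm x)) 0) measurableSet_Icc fun x _ => ?_).trans
      (setIntegral_eq_integral_of_forall_compl_eq_zero fun x hx => ?_)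
  · simp only [hface]; rfl
  · rw [h0 _ fun hxK => hx ?_]
    · simp
    · have h1 := fun j : Fin k => hR _ hxK j.succ
      exact ⟨fun j => (abs_lt.1 (h1 j)).1.le, fun j => (abs_lt.1 (h1 j)).2.le⟩

end HalfSpace

/-! ### The divergence in coordinates -/

section Coordinates

variable {m n : ℕ}

/-- In coordinates, `√det g · div X = ∑ᵢ ∂ᵢ(√det g · ξⁱ)` for a vector field `X = dψ ξ` tangent
to the immersion `ψ`. -/
theorem trace_fderiv_volDensity_smul {ψ X : 𝔼 m → 𝔼 n} {y : 𝔼 m} (hψ : ContDiffAt ℝ ∞ ψ y)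
    (hinj : Function.Injective (fderiv ℝ ψ y)) (hX : DifferentiableAt ℝ X y)
    (hXt : ∀ᶠ z in 𝓝 y, X z ∈ range (fderiv ℝ ψ z))
    (hinj' : ∀ᶠ z in 𝓝 y, Function.Injective (fderiv ℝ ψ z)) :
    DifferentiableAt ℝ
      (fun z => volDensity (fderiv ℝ ψ z) • tangentialPart (fderiv ℝ ψ z) (X z)) y ∧
    LinearMap.trace ℝ (𝔼 m) (fderiv ℝ (fun z => volDensity (fderiv ℝ ψ z) •
        tangentialPart (fderiv ℝ ψ z) (X z)) y : 𝔼 m →ₗ[ℝ] 𝔼 m) =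
      volDensity (fderiv ℝ ψ y) * LinearMap.trace ℝ (𝔼 m)
        (tangentialPart (fderiv ℝ ψ y) ∘L fderiv ℝ X y : 𝔼 m →L[ℝ] 𝔼 m) := by
  set A := fderiv ℝ ψ with hAdef
  have hA : ContDiffAt ℝ ∞ A y := hψ.fderiv_right (by simp)
  have hAd : DifferentiableAt ℝ A y := hA.differentiableAt (by simp)
  have htp : DifferentiableAt ℝ (fun z => tangentialPart (A z)) y :=
    ((contDiffAt_tangentialPart hinj).differentiableAt (by simp)).comp y hAd
  have hvd : DifferentiableAt ℝ volDensity (A y) :=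
    (contDiffAt_volDensity hinj).differentiableAt (by simp)
  set ξ : 𝔼 m → 𝔼 m := fun z => tangentialPart (A z) (X z) with hξ
  have hξd : DifferentiableAt ℝ ξ y := htp.clm_apply hX
  have hXξ : X =ᶠ[𝓝 y] fun z => A z (ξ z) := by
    filter_upwards [hXt, hinj'] with z ⟨u, hu⟩ hz
    simp only [hξ]
    rw [← hu, tangentialPart_apply_self hz]
  have hX' : ∀ v, fderiv ℝ X y v = fderiv ℝ A y v (ξ y) + A y (fderiv ℝ ξ y v) := by
    intro v
    rw [hXξ.fderiv_eq, fderiv_clm_apply hAd hξd]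
    simp [add_comm]
  have hsymm : ∀ v w, fderiv ℝ A y v w = fderiv ℝ A y w v :=
    (hψ.isSymmSndFDerivAt (by
      simpa using WithTop.coe_le_coe.2 (le_top : (2 : ℕ∞) ≤ ⊤))).eq
  have hvol : HasFDerivAt (fun z => volDensity (A z)) _ y :=
    hvd.hasFDerivAt.comp y hAd.hasFDerivAt
  have hη : HasFDerivAt (fun z => volDensity (A z) • tangentialPart (A z) (X z)) _ y :=
    hvol.smul hξd.hasFDerivAt
  refine ⟨hη.differentiableAt, ?_⟩
  rw [hη.fderiv]
  -- By the symmetry of `D²ψ`, `v ↦ D²ψ(v, ξ)` is the derivative of `dψ` in the direction `ξ`, whose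
  -- tangential trace is the logarithmic derivative of the volume density.
  have e1 : tangentialPart (A y) ∘L fderiv ℝ X y =
      tangentialPart (A y) ∘L fderiv ℝ A y (ξ y) + fderiv ℝ ξ y := by
    ext1 v
    simp only [ContinuousLinearMap.comp_apply, add_apply, hX', map_add]
    rw [hsymm, tangentialPart_apply_self hinj]
  rw [e1]
  simp only [ContinuousLinearMap.toLinearMap_add, ContinuousLinearMap.toLinearMap_smul, map_add,
    map_smul, smul_eq_mul]
  have e2 : LinearMap.trace ℝ (𝔼 m) ((ContinuousLinearMap.smulRight
      (fderiv ℝ volDensity (A y) ∘L fderiv ℝ A y) (ξ y) : 𝔼 m →L[ℝ] 𝔼 m) : 𝔼 m →ₗ[ℝ] 𝔼 m) =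
      (fderiv ℝ volDensity (A y) ∘L fderiv ℝ A y) (ξ y) :=
    LinearMap.trace_smulRight
      ((fderiv ℝ volDensity (A y) ∘L fderiv ℝ A y : 𝔼 m →L[ℝ] ℝ) : 𝔼 m →ₗ[ℝ] ℝ) (ξ y)
  rw [e2, ContinuousLinearMap.comp_apply, fderiv_volDensity hinj]
  ring

end Coordinates

/-! ### Charts of a manifold with boundary -/

section Charts

variable {k : ℕ} {M : Type*} [TopologicalSpace M] [ChartedSpace (EuclideanHalfSpace (k + 1)) M]

theorem mem_range_halfSpace {y : 𝔼 (k + 1)} : y ∈ range (𝓡∂ (k + 1)) ↔ 0 ≤ y 0 := by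
  rw [range_modelWithCornersEuclideanHalfSpace]; rfl

theorem nonneg_of_mem_target {c : M} {y : 𝔼 (k + 1)} (hy : y ∈ (extChartAt (𝓡∂ (k + 1)) c).target) :
    0 ≤ y 0 :=
  mem_range_halfSpace.1 (extChartAt_target_subset_range c hy)

theorem range_halfSpace_mem_nhds {y : 𝔼 (k + 1)} (hy : 0 < y 0) :
    range (𝓡∂ (k + 1)) ∈ 𝓝 y := by
  rw [← mem_interior_iff_mem_nhds, interior_range_modelWithCornersEuclideanHalfSpace]
  exact hy

theorem target_mem_nhds_of_pos {c : M} {y : 𝔼 (k + 1)}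
    (hy : y ∈ (extChartAt (𝓡∂ (k + 1)) c).target) (h0 : 0 < y 0) :
    (extChartAt (𝓡∂ (k + 1)) c).target ∈ 𝓝 y := by
  have h := extChartAt_target_mem_nhdsWithin_of_mem hy
  rwa [nhdsWithin_eq_nhds.2 (range_halfSpace_mem_nhds h0)] at h

theorem measurableSet_target (c : M) : MeasurableSet (extChartAt (𝓡∂ (k + 1)) c).target := by
  rw [extChartAt_target]
  exact ((chartAt _ c).open_target.preimage (𝓡∂ (k + 1)).continuous_symm).measurableSet.inter
    (𝓡∂ (k + 1)).isClosed_range.measurableSet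

/-- Extension by zero of a function on a chart domain which vanishes off a compact subset. -/
theorem continuousOn_indicator_target {F : Type*} [TopologicalSpace F] [Zero F] {c : M}
    {K : Set (𝔼 (k + 1))} (hK : IsCompact K) (hKT : K ⊆ (extChartAt (𝓡∂ (k + 1)) c).target)
    {f : 𝔼 (k + 1) → F} (hf : ContinuousOn f (extChartAt (𝓡∂ (k + 1)) c).target)
    (h0 : ∀ y ∈ (extChartAt (𝓡∂ (k + 1)) c).target, y ∉ K → f y = 0) :
    ContinuousOn (indicator (extChartAt (𝓡∂ (k + 1)) c).target f) {y | 0 ≤ y 0} := by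
  intro y hy
  by_cases hyT : y ∈ (extChartAt (𝓡∂ (k + 1)) c).target
  · have hT := extChartAt_target_mem_nhdsWithin_of_mem hyT
    have hset : {y : 𝔼 (k + 1) | 0 ≤ y 0} = range (𝓡∂ (k + 1)) :=
      (range_modelWithCornersEuclideanHalfSpace (k + 1)).symm
    rw [hset]
    have h1 : ContinuousWithinAt f (range (𝓡∂ (k + 1))) y :=
      (hf y hyT).mono_of_mem_nhdsWithin hT
    refine h1.congr_of_eventuallyEq ?_ (indicator_of_mem hyT f)
    filter_upwards [hT] with z hz using indicator_of_mem hz f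
  · have hyK : y ∉ K := fun h => hyT (hKT h)
    have h2 : indicator (extChartAt (𝓡∂ (k + 1)) c).target f =ᶠ[𝓝 y] fun _ => 0 := by
      filter_upwards [hK.isClosed.isOpen_compl.mem_nhds hyK] with z hz
      by_cases hzT : z ∈ (extChartAt (𝓡∂ (k + 1)) c).target
      · rw [indicator_of_mem hzT, h0 z hzT hz]
      · exact indicator_of_notMem hzT f
    exact (continuousAt_const.congr h2.symm).continuousWithinAt

theorem continuous_of_continuousOn_charts {F : Type*} [TopologicalSpace F] {g : M → F}
    (h : ∀ c : M, ContinuousOn (g ∘ (extChartAt (𝓡∂ (k + 1)) c).symm)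
      (extChartAt (𝓡∂ (k + 1)) c).target) : Continuous g := by
  rw [continuous_iff_continuousAt]
  intro p
  have h1 : ContinuousOn ((g ∘ (extChartAt (𝓡∂ (k + 1)) p).symm) ∘ extChartAt (𝓡∂ (k + 1)) p)
      (extChartAt (𝓡∂ (k + 1)) p).source :=
    (h p).comp (continuousOn_extChartAt p) (extChartAt (𝓡∂ (k + 1)) p).mapsTo
  have h2 : ContinuousOn g (extChartAt (𝓡∂ (k + 1)) p).source :=
    h1.congr fun q hq => congrArg g ((extChartAt (𝓡∂ (k + 1)) p).left_inv hq).symm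
  exact h2.continuousAt (extChartAt_source_mem_nhds p)

/-- The support of a function supported in a chart domain, seen in the chart. -/
theorem exists_compact_of_tsupport_subset [CompactSpace M] {F : Type*} [Zero F] {f : M → F} {c : M}
    (hf : tsupport f ⊆ (extChartAt (𝓡∂ (k + 1)) c).source) :
    ∃ K : Set (𝔼 (k + 1)), IsCompact K ∧ K ⊆ (extChartAt (𝓡∂ (k + 1)) c).target ∧
      ∀ y ∈ (extChartAt (𝓡∂ (k + 1)) c).target, y ∉ K →
        (extChartAt (𝓡∂ (k + 1)) c).symm y ∉ tsupport f := by
  refine ⟨extChartAt (𝓡∂ (k + 1)) c '' tsupport f,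
    (isClosed_tsupport f).isCompact.image_of_continuousOn ((continuousOn_extChartAt c).mono hf),
    ?_, fun y hy hyK h => hyK ⟨_, h, (extChartAt (𝓡∂ (k + 1)) c).right_inv hy⟩⟩
  rintro _ ⟨p, hp, rfl⟩
  exact (extChartAt (𝓡∂ (k + 1)) c).map_source (hf hp)

variable [IsManifold (𝓡∂ (k + 1)) ∞ M]

section General

variable {F : Type*} [NormedAddCommGroup F] [NormedSpace ℝ F]

theorem contDiffOn_comp_extChartAt_symm {g : M → F} (hg : ContMDiff (𝓡∂ (k + 1)) 𝓘(ℝ, F) ∞ g)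
    (c : M) : ContDiffOn ℝ ∞ (g ∘ (extChartAt (𝓡∂ (k + 1)) c).symm)
      (extChartAt (𝓡∂ (k + 1)) c).target :=
  (hg.comp_contMDiffOn (contMDiffOn_extChartAt_symm c)).contDiffOn

theorem contMDiff_of_contDiffOn_charts {g : M → F}
    (h : ∀ c : M, ContDiffOn ℝ ∞ (g ∘ (extChartAt (𝓡∂ (k + 1)) c).symm)
      (extChartAt (𝓡∂ (k + 1)) c).target) : ContMDiff (𝓡∂ (k + 1)) 𝓘(ℝ, F) ∞ g := by
  intro p
  have h1 : ContMDiffOn (𝓡∂ (k + 1)) 𝓘(ℝ, F) ∞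
      ((g ∘ (extChartAt (𝓡∂ (k + 1)) p).symm) ∘ extChartAt (𝓡∂ (k + 1)) p)
      (chartAt (EuclideanHalfSpace (k + 1)) p).source :=
    (h p).contMDiffOn.comp contMDiffOn_extChartAt fun q hq => by
      rw [← extChartAt_source (𝓡∂ (k + 1))] at hq
      exact (extChartAt (𝓡∂ (k + 1)) p).map_source hq
  have h2 : ContMDiffOn (𝓡∂ (k + 1)) 𝓘(ℝ, F) ∞ g
      (chartAt (EuclideanHalfSpace (k + 1)) p).source :=
    h1.congr fun q hq => by
      rw [← extChartAt_source (𝓡∂ (k + 1))] at hq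
      exact congrArg g ((extChartAt (𝓡∂ (k + 1)) p).left_inv hq).symm
  exact h2.contMDiffAt ((chartAt _ p).open_source.mem_nhds (mem_chart_source _ p))

theorem contDiffOn_fderivWithin_chart {g : M → F} (hg : ContMDiff (𝓡∂ (k + 1)) 𝓘(ℝ, F) ∞ g)
    (c : M) : ContDiffOn ℝ ∞
      (fderivWithin ℝ (g ∘ (extChartAt (𝓡∂ (k + 1)) c).symm) (range (𝓡∂ (k + 1))))
      (extChartAt (𝓡∂ (k + 1)) c).target := by
  have h := (contDiffOn_comp_extChartAt_symm hg c).fderivWithin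
    (uniqueDiffOn_extChartAt_target c) (m := ∞) (by simp)
  refine h.congr fun y hy => ?_
  exact (fderivWithin_congr_set (extChartAt_target_eventuallyEq_of_mem hy)).symm

/-- The differential at `p` of the chart around `c`, the tangent space at `p` being identified
with `ℝᵏ⁺¹` by means of the preferred chart at `p`. -/
def chartTangentMap (k : ℕ) {M : Type*} [TopologicalSpace M]
    [ChartedSpace (EuclideanHalfSpace (k + 1)) M] (c p : M) : 𝔼 (k + 1) →L[ℝ] 𝔼 (k + 1) :=
  mfderiv (𝓡∂ (k + 1)) 𝓘(ℝ, 𝔼 (k + 1)) (extChartAt (𝓡∂ (k + 1)) c) p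

theorem chartTangentMap_isInvertible {c p : M} (hp : p ∈ (extChartAt (𝓡∂ (k + 1)) c).source) :
    (chartTangentMap k c p).IsInvertible :=
  have : IsManifold (𝓡∂ (k + 1)) 1 M := IsManifold.of_le (n := ∞) (by simp)
  isInvertible_mfderiv_extChartAt hp

/-- The chain rule for the passage from the preferred chart at `p` to the chart around `c`. -/
theorem mfderiv_eq_fderivWithin_chart {g : M → F} (hg : ContMDiff (𝓡∂ (k + 1)) 𝓘(ℝ, F) ∞ g)
    {c p : M} (hp : p ∈ (extChartAt (𝓡∂ (k + 1)) c).source) :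
    (mfderiv (𝓡∂ (k + 1)) 𝓘(ℝ, F) g p : 𝔼 (k + 1) →L[ℝ] F) =
      fderivWithin ℝ (g ∘ (extChartAt (𝓡∂ (k + 1)) c).symm) (range (𝓡∂ (k + 1)))
        (extChartAt (𝓡∂ (k + 1)) c p) ∘L chartTangentMap k c p := by
  have : IsManifold (𝓡∂ (k + 1)) 1 M := IsManifold.of_le (n := ∞) (by simp)
  have hy := (extChartAt (𝓡∂ (k + 1)) c).map_source hp
  have h1 : HasFDerivWithinAt (g ∘ (extChartAt (𝓡∂ (k + 1)) c).symm) _ (range (𝓡∂ (k + 1)))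
      (extChartAt (𝓡∂ (k + 1)) c p) :=
    (((contDiffOn_comp_extChartAt_symm hg c).differentiableOn (by simp) _ hy).mono_of_mem_nhdsWithin
      (extChartAt_target_mem_nhdsWithin_of_mem hy)).hasFDerivWithinAt
  have hp' : p ∈ (chartAt (EuclideanHalfSpace (k + 1)) c).source := by
    rwa [extChartAt_source] at hp
  have h2 : HasMFDerivAt (𝓡∂ (k + 1)) 𝓘(ℝ, 𝔼 (k + 1)) (extChartAt (𝓡∂ (k + 1)) c) p
      (chartTangentMap k c p) := (mdifferentiableAt_extChartAt hp').hasMFDerivAt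
  have h3 := h1.hasMFDerivWithinAt.comp p h2.hasMFDerivWithinAt
    (s := univ) (fun q _ => mem_range_self _)
  rw [hasMFDerivWithinAt_univ] at h3
  have h4 : g =ᶠ[𝓝 p] (g ∘ (extChartAt (𝓡∂ (k + 1)) c).symm) ∘ extChartAt (𝓡∂ (k + 1)) c := by
    filter_upwards [(isOpen_extChartAt_source (I := 𝓡∂ (k + 1)) c).mem_nhds hp] with q hq
    exact congrArg g ((extChartAt (𝓡∂ (k + 1)) c).left_inv hq).symm
  exact (h3.congr_of_eventuallyEq h4).mfderiv

end General

/-! ### Boundary points -/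

theorem mem_boundary_of_coord_eq_zero {c : M} {y : 𝔼 (k + 1)}
    (hy : y ∈ (extChartAt (𝓡∂ (k + 1)) c).target) (h0 : y 0 = 0) :
    (extChartAt (𝓡∂ (k + 1)) c).symm y ∈ (𝓡∂ (k + 1)).boundary M := by
  have hp := (extChartAt (𝓡∂ (k + 1)) c).map_target hy
  rw [extChartAt_source] at hp
  refine (ModelWithCorners.isBoundaryPoint_iff_of_mem_atlas (n := ∞) (by simp)
    (chart_mem_atlas _ c) hp).2 ?_
  change extChartAt (𝓡∂ (k + 1)) c _ ∈ frontier (extChartAt (𝓡∂ (k + 1)) c).target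
  rw [(extChartAt (𝓡∂ (k + 1)) c).right_inv hy]
  refine ⟨subset_closure hy, fun hint => ?_⟩
  have h1 := interior_mono (extChartAt_target_subset_range c) hint
  rw [interior_range_modelWithCornersEuclideanHalfSpace] at h1
  exact (ne_of_gt h1) h0

/-- At a boundary point, the changes of charts preserve the tangent space of the boundary and the
inward side. -/
theorem chartTangentMap_coord_zero {c p : M} (hp : p ∈ (extChartAt (𝓡∂ (k + 1)) c).source)
    (hb : p ∈ (𝓡∂ (k + 1)).boundary M) :
    ∃ a : ℝ, 0 < a ∧ ∀ u : 𝔼 (k + 1), chartTangentMap k c p u 0 = a * u 0 := by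
  have : IsManifold (𝓡∂ (k + 1)) 1 M := IsManifold.of_le (n := ∞) (by simp)
  have hp' : p ∈ (chartAt (EuclideanHalfSpace (k + 1)) c).source := by
    rwa [extChartAt_source] at hp
  have hcoord : ∀ e : M, p ∈ (extChartAt (𝓡∂ (k + 1)) e).source →
      extChartAt (𝓡∂ (k + 1)) e p 0 = 0 := by
    intro e he
    have h1 := (extChartAt (𝓡∂ (k + 1)) e).map_source he
    by_contra hne
    have hpos : 0 < extChartAt (𝓡∂ (k + 1)) e p 0 :=
      lt_of_le_of_ne (nonneg_of_mem_target h1) (Ne.symm hne)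
    have he' : p ∈ (chartAt (EuclideanHalfSpace (k + 1)) e).source := by
      rwa [extChartAt_source] at he
    have h2 := (ModelWithCorners.isBoundaryPoint_iff_of_mem_atlas (n := ∞) (by simp)
      (chart_mem_atlas _ e) he').1 hb
    exact h2.2 (mem_interior_iff_mem_nhds.2 (target_mem_nhds_of_pos h1 hpos))
  have hd : HasFDerivWithinAt
      (writtenInExtChartAt (𝓡∂ (k + 1)) 𝓘(ℝ, 𝔼 (k + 1)) p (extChartAt (𝓡∂ (k + 1)) c))
      (chartTangentMap k c p) (range (𝓡∂ (k + 1))) (extChartAt (𝓡∂ (k + 1)) p p) :=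
    (mdifferentiableAt_extChartAt hp').hasMFDerivAt.2
  have hd0 := (EuclideanSpace.proj (0 : Fin (k + 1)) :
    𝔼 (k + 1) →L[ℝ] ℝ).hasFDerivAt.comp_hasFDerivWithinAt _ hd
  -- The zeroth coordinate of the transition map vanishes at `p` and is nonnegative nearby, so its
  -- derivative is nonnegative in the inward directions.
  have hmin : IsLocalMinOn
      ((EuclideanSpace.proj (0 : Fin (k + 1)) : 𝔼 (k + 1) →L[ℝ] ℝ) ∘
        writtenInExtChartAt (𝓡∂ (k + 1)) 𝓘(ℝ, 𝔼 (k + 1)) p (extChartAt (𝓡∂ (k + 1)) c))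
      (range (𝓡∂ (k + 1))) (extChartAt (𝓡∂ (k + 1)) p p) := by
    refine Filter.Eventually.of_forall fun z => ?_
    have e1 : ((EuclideanSpace.proj (0 : Fin (k + 1)) : 𝔼 (k + 1) →L[ℝ] ℝ) ∘
        writtenInExtChartAt (𝓡∂ (k + 1)) 𝓘(ℝ, 𝔼 (k + 1)) p (extChartAt (𝓡∂ (k + 1)) c))
        (extChartAt (𝓡∂ (k + 1)) p p) = 0 := by
      simp only [Function.comp_apply, writtenInExtChartAt, extChartAt_to_inv]
      exact hcoord c hp
    rw [e1]
    exact mem_range_halfSpace.1 (mem_range_self _)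
  have hnonneg : ∀ u : 𝔼 (k + 1), 0 ≤ u 0 → 0 ≤ chartTangentMap k c p u 0 := by
    intro u hu
    refine hmin.hasFDerivWithinAt_nonneg hd0 (mem_posTangentConeAt_of_segment_subset ?_)
    refine (𝓡∂ (k + 1)).convex_range.segment_subset (mem_range_self _) ?_
    rw [mem_range_halfSpace]
    rw [PiLp.add_apply, hcoord p (mem_extChartAt_source p), zero_add]
    exact hu
  have hzero : ∀ u : 𝔼 (k + 1), u 0 = 0 → chartTangentMap k c p u 0 = 0 := by
    intro u hu
    have h1 := hnonneg u hu.ge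
    have h2 := hnonneg (-u) (by simp [hu])
    rw [map_neg, PiLp.neg_apply] at h2
    linarith
  have hlin : ∀ u : 𝔼 (k + 1), chartTangentMap k c p u 0 =
      chartTangentMap k c p (EuclideanSpace.single 0 1) 0 * u 0 := by
    intro u
    have h1 := hzero (u - u 0 • EuclideanSpace.single 0 1) (by simp)
    rw [map_sub, map_smul, PiLp.sub_apply, PiLp.smul_apply, smul_eq_mul] at h1
    linarith
  refine ⟨_, lt_of_le_of_ne (hnonneg _ (by simp)) fun h => ?_, hlin⟩
  obtain ⟨u, hu⟩ := (chartTangentMap_isInvertible hp).surjective (EuclideanSpace.single 0 1)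
  have h2 := hlin u
  rw [hu, ← h] at h2
  simp at h2

end Charts

/-! ### Gradient and divergence in charts -/

section Geometry

variable {k n : ℕ} {M : Type*} [TopologicalSpace M] [ChartedSpace (EuclideanHalfSpace (k + 1)) M]
  {ψ X : M → 𝔼 n} {f : M → ℝ}

theorem surfaceGradient_eq_gradientVec (ψ : M → 𝔼 n) (f : M → ℝ) (p : M) :
    surfaceGradient k ψ f p = gradientVec (diffAt k ψ p) (functionDiffAt k f p) := rfl

theorem surfaceGradient_mem_range (ψ : M → 𝔼 n) (f : M → ℝ) (p : M) :
    surfaceGradient k ψ f p ∈ range (diffAt k ψ p) := ⟨_, rfl⟩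

theorem inner_surfaceGradient (hinj : ∀ p, Function.Injective (diffAt k ψ p)) (p : M)
    (u : 𝔼 (k + 1)) : ⟪surfaceGradient k ψ f p, diffAt k ψ p u⟫_ℝ = functionDiffAt k f p u := by
  rw [surfaceGradient_eq_gradientVec, inner_gradientVec (hinj p)]

theorem surfaceDivergence_eq_zero_of_notMem_tsupport {p : M} (hp : p ∉ tsupport X) :
    surfaceDivergence k ψ X p = 0 := by
  have h : diffAt k X p = 0 := by
    have h1 : X =ᶠ[𝓝 p] fun _ => 0 := notMem_tsupport_iff_eventuallyEq.1 hp
    rw [diffAt, h1.mfderiv_eq, mfderiv_const]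
    rfl
  rw [surfaceDivergence, h, ContinuousLinearMap.comp_zero, ContinuousLinearMap.toLinearMap_zero,
    map_zero]

variable [IsManifold (𝓡∂ (k + 1)) ∞ M]

theorem diffAt_eq_chartDiff {l : ℕ} {g : M → 𝔼 l}
    (hg : ContMDiff (𝓡∂ (k + 1)) 𝓘(ℝ, 𝔼 l) ∞ g) {c : M} {y : 𝔼 (k + 1)}
    (hy : y ∈ (extChartAt (𝓡∂ (k + 1)) c).target) :
    diffAt k g ((extChartAt (𝓡∂ (k + 1)) c).symm y) = chartDiff k g c y ∘L
      chartTangentMap k c ((extChartAt (𝓡∂ (k + 1)) c).symm y) := by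
  rw [diffAt, mfderiv_eq_fderivWithin_chart hg ((extChartAt (𝓡∂ (k + 1)) c).map_target hy),
    (extChartAt (𝓡∂ (k + 1)) c).right_inv hy, chartDiff]

theorem chartTangentMap_isInvertible_of_target {c : M} {y : 𝔼 (k + 1)}
    (hy : y ∈ (extChartAt (𝓡∂ (k + 1)) c).target) :
    (chartTangentMap k c ((extChartAt (𝓡∂ (k + 1)) c).symm y)).IsInvertible :=
  chartTangentMap_isInvertible ((extChartAt (𝓡∂ (k + 1)) c).map_target hy)

theorem chartDiff_injective (hψ : ContMDiff (𝓡∂ (k + 1)) 𝓘(ℝ, 𝔼 n) ∞ ψ)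
    (hinj : ∀ p, Function.Injective (diffAt k ψ p)) {c : M} {y : 𝔼 (k + 1)}
    (hy : y ∈ (extChartAt (𝓡∂ (k + 1)) c).target) : Function.Injective (chartDiff k ψ c y) := by
  have h := hinj ((extChartAt (𝓡∂ (k + 1)) c).symm y)
  rw [diffAt_eq_chartDiff hψ hy] at h
  intro a b hab
  obtain ⟨a', rfl⟩ := (chartTangentMap_isInvertible_of_target hy).surjective a
  obtain ⟨b', rfl⟩ := (chartTangentMap_isInvertible_of_target hy).surjective b
  rw [h hab]

theorem mem_range_chartDiff (hψ : ContMDiff (𝓡∂ (k + 1)) 𝓘(ℝ, 𝔼 n) ∞ ψ) {c : M} {y : 𝔼 (k + 1)}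
    (hy : y ∈ (extChartAt (𝓡∂ (k + 1)) c).target) {v : 𝔼 n}
    (hv : v ∈ range (diffAt k ψ ((extChartAt (𝓡∂ (k + 1)) c).symm y))) :
    v ∈ range (chartDiff k ψ c y) := by
  obtain ⟨u, rfl⟩ := hv
  rw [diffAt_eq_chartDiff hψ hy]
  exact ⟨_, rfl⟩

theorem contDiffOn_chartDiff {l : ℕ} {g : M → 𝔼 l}
    (hg : ContMDiff (𝓡∂ (k + 1)) 𝓘(ℝ, 𝔼 l) ∞ g) (c : M) :
    ContDiffOn ℝ ∞ (chartDiff k g c) (extChartAt (𝓡∂ (k + 1)) c).target :=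
  contDiffOn_fderivWithin_chart hg c

theorem surfaceGradient_chart (hψ : ContMDiff (𝓡∂ (k + 1)) 𝓘(ℝ, 𝔼 n) ∞ ψ)
    (hinj : ∀ p, Function.Injective (diffAt k ψ p))
    (hf : ContMDiff (𝓡∂ (k + 1)) 𝓘(ℝ, ℝ) ∞ f) {c : M} {y : 𝔼 (k + 1)}
    (hy : y ∈ (extChartAt (𝓡∂ (k + 1)) c).target) :
    surfaceGradient k ψ f ((extChartAt (𝓡∂ (k + 1)) c).symm y) =
      gradientVec (chartDiff k ψ c y) (fderivWithin ℝ (f ∘ (extChartAt (𝓡∂ (k + 1)) c).symm)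
        (range (𝓡∂ (k + 1))) y) := by
  have h : functionDiffAt k f ((extChartAt (𝓡∂ (k + 1)) c).symm y) =
      fderivWithin ℝ (f ∘ (extChartAt (𝓡∂ (k + 1)) c).symm) (range (𝓡∂ (k + 1))) y ∘L
        chartTangentMap k c ((extChartAt (𝓡∂ (k + 1)) c).symm y) := by
    rw [functionDiffAt,
      mfderiv_eq_fderivWithin_chart hf ((extChartAt (𝓡∂ (k + 1)) c).map_target hy),
      (extChartAt (𝓡∂ (k + 1)) c).right_inv hy]
  rw [surfaceGradient_eq_gradientVec, h, diffAt_eq_chartDiff hψ hy,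
    gradientVec_comp (chartDiff_injective hψ hinj hy) _ (chartTangentMap_isInvertible_of_target hy)]

theorem contMDiff_surfaceGradient (hψ : ContMDiff (𝓡∂ (k + 1)) 𝓘(ℝ, 𝔼 n) ∞ ψ)
    (hinj : ∀ p, Function.Injective (diffAt k ψ p))
    (hf : ContMDiff (𝓡∂ (k + 1)) 𝓘(ℝ, ℝ) ∞ f) :
    ContMDiff (𝓡∂ (k + 1)) 𝓘(ℝ, 𝔼 n) ∞ (surfaceGradient k ψ f) := by
  refine contMDiff_of_contDiffOn_charts fun c => ?_
  have h1 := contDiffOn_chartDiff hψ c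
  have h2 := contDiffOn_fderivWithin_chart hf c
  have h3 : ContDiffOn ℝ ∞ (fun y => (gramOp (chartDiff k ψ c y)).inverse)
      (extChartAt (𝓡∂ (k + 1)) c).target := fun y hy =>
    (contDiffAt_gramOp_inverse (chartDiff_injective hψ hinj hy)).comp_contDiffWithinAt y (h1 y hy)
  have h4 : ContDiffOn ℝ ∞ (fun y => (InnerProductSpace.toDual ℝ (𝔼 (k + 1))).symm
      (fderivWithin ℝ (f ∘ (extChartAt (𝓡∂ (k + 1)) c).symm) (range (𝓡∂ (k + 1))) y))
      (extChartAt (𝓡∂ (k + 1)) c).target := by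
    have hb : IsBoundedLinearMap ℝ (fun α : 𝔼 (k + 1) →L[ℝ] ℝ =>
        (InnerProductSpace.toDual ℝ (𝔼 (k + 1))).symm α) :=
      IsLinearMap.with_bound ⟨map_add _, fun c x => by simp⟩ 1 fun A => by simp
    exact hb.contDiff.comp_contDiffOn h2
  exact (h1.clm_apply (h3.clm_apply h4)).congr fun y hy => surfaceGradient_chart hψ hinj hf hy

theorem surfaceDivergence_chart (hψ : ContMDiff (𝓡∂ (k + 1)) 𝓘(ℝ, 𝔼 n) ∞ ψ)
    (hX : ContMDiff (𝓡∂ (k + 1)) 𝓘(ℝ, 𝔼 n) ∞ X) {c : M} {y : 𝔼 (k + 1)}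
    (hy : y ∈ (extChartAt (𝓡∂ (k + 1)) c).target) :
    surfaceDivergence k ψ X ((extChartAt (𝓡∂ (k + 1)) c).symm y) =
      LinearMap.trace ℝ (𝔼 (k + 1)) (tangentialPart (chartDiff k ψ c y) ∘L chartDiff k X c y :
        𝔼 (k + 1) →L[ℝ] 𝔼 (k + 1)) := by
  have hL := chartTangentMap_isInvertible_of_target hy
  rw [surfaceDivergence, diffAt_eq_chartDiff hψ hy, diffAt_eq_chartDiff hX hy,
    tangentialPart_comp hL]
  exact trace_conj_inverse hL (tangentialPart (chartDiff k ψ c y) ∘L chartDiff k X c y)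

theorem continuousOn_tangentialPart_chart (hψ : ContMDiff (𝓡∂ (k + 1)) 𝓘(ℝ, 𝔼 n) ∞ ψ)
    (hinj : ∀ p, Function.Injective (diffAt k ψ p)) (c : M) :
    ContinuousOn (fun y => tangentialPart (chartDiff k ψ c y))
      (extChartAt (𝓡∂ (k + 1)) c).target := fun y hy =>
  (contDiffAt_tangentialPart (chartDiff_injective hψ hinj hy)).continuousAt.comp_continuousWithinAt
    ((contDiffOn_chartDiff hψ c).continuousOn y hy)

theorem continuousOn_volDensity_chart (hψ : ContMDiff (𝓡∂ (k + 1)) 𝓘(ℝ, 𝔼 n) ∞ ψ)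
    (hinj : ∀ p, Function.Injective (diffAt k ψ p)) (c : M) :
    ContinuousOn (fun y => volDensity (chartDiff k ψ c y))
      (extChartAt (𝓡∂ (k + 1)) c).target := fun y hy =>
  (contDiffAt_volDensity (chartDiff_injective hψ hinj hy)).continuousAt.comp_continuousWithinAt
    ((contDiffOn_chartDiff hψ c).continuousOn y hy)

theorem continuous_surfaceDivergence (hψ : ContMDiff (𝓡∂ (k + 1)) 𝓘(ℝ, 𝔼 n) ∞ ψ)
    (hinj : ∀ p, Function.Injective (diffAt k ψ p))
    (hX : ContMDiff (𝓡∂ (k + 1)) 𝓘(ℝ, 𝔼 n) ∞ X) : Continuous (surfaceDivergence k ψ X) := by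
  refine continuous_of_continuousOn_charts (k := k) fun c => ?_
  let tr : (𝔼 (k + 1) →L[ℝ] 𝔼 (k + 1)) →ₗ[ℝ] ℝ :=
    { toFun := fun G => LinearMap.trace ℝ (𝔼 (k + 1)) (G : 𝔼 (k + 1) →ₗ[ℝ] 𝔼 (k + 1))
      map_add' := fun G K => by rw [ContinuousLinearMap.toLinearMap_add, map_add]
      map_smul' := fun a G => by
        rw [ContinuousLinearMap.toLinearMap_smul, map_smul, RingHom.id_apply] }
  have h : ContinuousOn (fun y => tr (tangentialPart (chartDiff k ψ c y) ∘L chartDiff k X c y))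
      (extChartAt (𝓡∂ (k + 1)) c).target :=
    (LinearMap.continuous_of_finiteDimensional tr).comp_continuousOn
      ((continuousOn_tangentialPart_chart hψ hinj c).clm_comp
        (contDiffOn_chartDiff hX c).continuousOn)
  exact h.congr fun y hy => surfaceDivergence_chart hψ hX hy

/-- The outward conormal in the coordinates of an arbitrary chart. -/
theorem IsOutwardConormal.chart (hψ : ContMDiff (𝓡∂ (k + 1)) 𝓘(ℝ, 𝔼 n) ∞ ψ) {c : M}
    {y : 𝔼 (k + 1)} (hy : y ∈ (extChartAt (𝓡∂ (k + 1)) c).target) (h0 : y 0 = 0) {ν : 𝔼 n}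
    (hν : IsOutwardConormal k ψ ((extChartAt (𝓡∂ (k + 1)) c).symm y) ν) :
    ∃ w : 𝔼 (k + 1), w 0 < 0 ∧ chartDiff k ψ c y w = ν ∧
      ∀ u : 𝔼 (k + 1), u 0 = 0 → ⟪chartDiff k ψ c y u, ν⟫_ℝ = 0 := by
  obtain ⟨a, ha, hL⟩ := chartTangentMap_coord_zero ((extChartAt (𝓡∂ (k + 1)) c).map_target hy)
    (mem_boundary_of_coord_eq_zero hy h0)
  obtain ⟨w, hw, hwν⟩ := hν.tangent_outward
  rw [diffAt_eq_chartDiff hψ hy, ContinuousLinearMap.comp_apply] at hwν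
  refine ⟨_, ?_, hwν, fun u hu => ?_⟩
  · rw [hL]; exact mul_neg_of_pos_of_neg ha hw
  · obtain ⟨u, rfl⟩ := (chartTangentMap_isInvertible_of_target hy).surjective u
    rw [hL] at hu
    have := hν.orthogonal u ((mul_eq_zero.1 hu).resolve_left ha.ne')
    rwa [diffAt_eq_chartDiff hψ hy] at this

/-- The divergence theorem for a tangent vector field supported in the domain of one chart. -/
theorem integral_surfaceDivergence_chart [CompactSpace M]
    (hψ : ContMDiff (𝓡∂ (k + 1)) 𝓘(ℝ, 𝔼 n) ∞ ψ)
    (hinj : ∀ p, Function.Injective (diffAt k ψ p))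
    (hX : ContMDiff (𝓡∂ (k + 1)) 𝓘(ℝ, 𝔼 n) ∞ X) (hXt : ∀ p, X p ∈ range (diffAt k ψ p))
    {c : M} (hsupp : tsupport X ⊆ (extChartAt (𝓡∂ (k + 1)) c).source) {ν : M → 𝔼 n}
    (hν : ∀ p ∈ (𝓡∂ (k + 1)).boundary M, IsOutwardConormal k ψ p (ν p)) :
    ∫ y in (extChartAt (𝓡∂ (k + 1)) c).target, volDensity (chartDiff k ψ c y) *
        surfaceDivergence k ψ X ((extChartAt (𝓡∂ (k + 1)) c).symm y) =
      ∫ z in faceInclusion k ⁻¹' (extChartAt (𝓡∂ (k + 1)) c).target,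
        volDensity (chartDiff k ψ c (faceInclusion k z) ∘L faceInclusion k) *
          ⟪X ((extChartAt (𝓡∂ (k + 1)) c).symm (faceInclusion k z)),
            ν ((extChartAt (𝓡∂ (k + 1)) c).symm (faceInclusion k z))⟫_ℝ := by
  set T := (extChartAt (𝓡∂ (k + 1)) c).target with hT
  set e := extChartAt (𝓡∂ (k + 1)) c with he
  have hTm : MeasurableSet T := measurableSet_target c
  obtain ⟨K, hK, hKT, hnot⟩ : ∃ K, IsCompact K ∧ K ⊆ T ∧ ∀ y ∈ T, y ∉ K → e.symm y ∉ tsupport X :=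
    exists_compact_of_tsupport_subset hsupp
  have hX0 : ∀ y ∈ T, y ∉ K → X (e.symm y) = 0 := fun y hy hyK =>
    image_eq_zero_of_notMem_tsupport (hnot y hy hyK)
  let ξ : 𝔼 (k + 1) → 𝔼 (k + 1) := fun y =>
    volDensity (chartDiff k ψ c y) • tangentialPart (chartDiff k ψ c y) (X (e.symm y))
  let D : 𝔼 (k + 1) → ℝ := fun y =>
    volDensity (chartDiff k ψ c y) * surfaceDivergence k ψ X (e.symm y)
  have hξ0 : ∀ y ∈ T, y ∉ K → ξ y = 0 := fun y hy hyK => by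
    simp only [ξ, hX0 y hy hyK, map_zero, smul_zero]
  have hD0 : ∀ y ∈ T, y ∉ K → D y = 0 := fun y hy hyK => by
    simp only [D, surfaceDivergence_eq_zero_of_notMem_tsupport (hnot y hy hyK), mul_zero]
  have hvol := continuousOn_volDensity_chart hψ hinj c
  have hξc : ContinuousOn ξ T := hvol.smul ((continuousOn_tangentialPart_chart hψ hinj c).clm_apply
    (contDiffOn_comp_extChartAt_symm hX c).continuousOn)
  have hDc : ContinuousOn D T := hvol.mul
    ((continuous_surfaceDivergence hψ hinj hX).comp_continuousOn (continuousOn_extChartAt_symm c))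
  have hzero : ∀ {F : Type} [Zero F] (g : 𝔼 (k + 1) → F), (∀ y ∈ T, y ∉ K → g y = 0) →
      ∀ y, y ∉ K → indicator T g y = 0 := by
    intro F _ g hg y hyK
    by_cases hy : y ∈ T
    · rw [indicator_of_mem hy, hg y hy hyK]
    · exact indicator_of_notMem hy g
  -- Extended by zero, `√det g ξ` is a field on the half space with divergence `√det g · div X`.
  have main := integral_divergence_halfSpace (η := indicator T ξ) (D := indicator T D) hK
    (hzero ξ hξ0) (continuousOn_indicator_target hK hKT hξc hξ0)
    (continuousOn_indicator_target hK hKT hDc hD0) (hzero D hD0) (fun y hy => by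
      by_cases hyT : y ∈ T
      · have hTn : T ∈ 𝓝 y := target_mem_nhds_of_pos hyT hy
        have hpos : ∀ᶠ z : 𝔼 (k + 1) in 𝓝 y, 0 < z 0 :=
          (EuclideanSpace.proj (0 : Fin (k + 1)) :
            𝔼 (k + 1) →L[ℝ] ℝ).continuous.continuousAt.eventually (lt_mem_nhds hy)
        have hfd : ∀ g : M → 𝔼 n, ∀ z : 𝔼 (k + 1), 0 < z 0 →
            chartDiff k g c z = fderiv ℝ (g ∘ e.symm) z := fun g z hz =>
          fderivWithin_of_mem_nhds (range_halfSpace_mem_nhds hz)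
        have h1 := trace_fderiv_volDensity_smul (ψ := ψ ∘ e.symm) (X := X ∘ e.symm) (y := y)
          ((contDiffOn_comp_extChartAt_symm hψ c).contDiffAt hTn)
          (by rw [← hfd ψ y hy]; exact chartDiff_injective hψ hinj hyT)
          (((contDiffOn_comp_extChartAt_symm hX c).contDiffAt hTn).differentiableAt (by simp))
          (by
            filter_upwards [hpos, hTn] with z hz hzT
            rw [← hfd ψ z hz]
            exact mem_range_chartDiff hψ hzT (hXt _))
          (by
            filter_upwards [hpos, hTn] with z hz hzT
            rw [← hfd ψ z hz]
            exact chartDiff_injective hψ hinj hzT)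
        have h2 : indicator T ξ =ᶠ[𝓝 y] fun z => volDensity (fderiv ℝ (ψ ∘ e.symm) z) •
            tangentialPart (fderiv ℝ (ψ ∘ e.symm) z) ((X ∘ e.symm) z) := by
          filter_upwards [hpos, hTn] with z hz hzT
          rw [indicator_of_mem hzT, ← hfd ψ z hz]
          rfl
        refine ⟨h1.1.congr_of_eventuallyEq h2, ?_⟩
        rw [h2.fderiv_eq, h1.2, indicator_of_mem hyT, ← hfd ψ y hy, ← hfd X y hy,
          ← surfaceDivergence_chart hψ hX hyT]
      · have hyK : y ∉ K := fun h => hyT (hKT h)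
        have h2 : indicator T ξ =ᶠ[𝓝 y] fun _ => 0 := by
          filter_upwards [hK.isClosed.isOpen_compl.mem_nhds hyK] with z hz using hzero ξ hξ0 z hz
        refine ⟨(differentiableAt_const _).congr_of_eventuallyEq h2, ?_⟩
        rw [h2.fderiv_eq, indicator_of_notMem hyT]
        simp)
  have hTsub : {y : 𝔼 (k + 1) | 0 ≤ y 0} ∩ T = T :=
    inter_eq_right.2 fun y hy => nonneg_of_mem_target hy
  rw [setIntegral_indicator hTm, hTsub] at main
  rw [main, ← integral_neg, ← integral_indicator ((faceInclusion k).continuous.measurable hTm)]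
  congr 1
  ext z
  by_cases hz : faceInclusion k z ∈ T
  · rw [indicator_of_mem hz, indicator_of_mem (show z ∈ faceInclusion k ⁻¹' T from hz)]
    have hνz := hν _ (mem_boundary_of_coord_eq_zero hz (faceInclusion_zero z))
    obtain ⟨w, hw, hwν, horth⟩ := hνz.chart hψ hz (faceInclusion_zero z)
    obtain ⟨u, hu⟩ := mem_range_chartDiff hψ hz (hXt _)
    have hflux := flux_through_face (chartDiff k ψ c (faceInclusion k z)) hw
      (by rw [hwν, hνz.norm_eq_one]) (by rw [hwν]; exact horth) u
    rw [hwν, hu] at hflux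
    rw [hflux]
    have hξu : ξ (faceInclusion k z) = volDensity (chartDiff k ψ c (faceInclusion k z)) • u := by
      simp only [ξ]
      rw [← hu, tangentialPart_apply_self (chartDiff_injective hψ hinj hz)]
    rw [hξu, PiLp.smul_apply, smul_eq_mul]
  · rw [indicator_of_notMem hz, indicator_of_notMem (show z ∉ faceInclusion k ⁻¹' T from hz)]
    simp

end Geometry

/-! ### Integration against the Riemannian measures -/

section Measures

theorem measure_sum_eq_finsetSum {ι α : Type*} [MeasurableSpace α] {μ : ι → Measure α}
    {S : Finset ι} (h : ∀ i, i ∉ S → μ i = 0) : Measure.sum μ = ∑ i ∈ S, μ i := by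
  ext s hs
  rw [Measure.sum_apply _ hs, Measure.finsetSum_apply, tsum_eq_sum]
  intro i hi
  rw [h i hi, Measure.coe_zero, Pi.zero_apply]

theorem integrableOn_of_continuousOn_of_compact {m : ℕ} {U K : Set (𝔼 m)} (hU : MeasurableSet U)
    (hK : IsCompact K) (hKU : K ⊆ U) {f : 𝔼 m → ℝ} (hf : ContinuousOn f U)
    (h0 : ∀ y ∈ U, y ∉ K → f y = 0) : IntegrableOn f U :=
  ((hf.mono hKU).integrableOn_compact hK).of_forall_sdiff_eq_zero hU fun y hy => h0 y hy.1 hy.2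

/-- Integration against the image under a parametrization `h` of a measure with continuous,
compactly supported density. -/
theorem integral_map_withDensity {m : ℕ} {M : Type*} [TopologicalSpace M] [MeasurableSpace M]
    [BorelSpace M] {U K : Set (𝔼 m)} (hU : MeasurableSet U) (hK : IsCompact K) (hKU : K ⊆ U)
    {h : 𝔼 m → M} (hh : ContinuousOn h U) {w : 𝔼 m → ℝ} (hw : ContinuousOn w U)
    (hw0 : ∀ y ∈ U, 0 ≤ w y) (hwK : ∀ y ∈ U, y ∉ K → w y = 0) {f : M → ℝ} (hf : Continuous f) :
    Integrable f (((volume.restrict U).withDensity fun y => ENNReal.ofReal (w y)).map h) ∧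
    ∫ p, f p ∂(((volume.restrict U).withDensity fun y => ENNReal.ofReal (w y)).map h) =
      ∫ y in U, w y * f (h y) := by
  have hm : AEMeasurable (fun y => ENNReal.ofReal (w y)) (volume.restrict U) :=
    (hw.aemeasurable hU).ennreal_ofReal
  have hhm : AEMeasurable h ((volume.restrict U).withDensity fun y => ENNReal.ofReal (w y)) :=
    (hh.aemeasurable hU).mono_ac (withDensity_absolutelyContinuous _ _)
  have hlt : ∀ᵐ y ∂(volume.restrict U), ENNReal.ofReal (w y) < ⊤ :=
    Filter.Eventually.of_forall fun y => ENNReal.ofReal_lt_top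
  have hcongr : EqOn (fun y => (ENNReal.ofReal (w y)).toReal • f (h y))
      (fun y => w y * f (h y)) U :=
    fun y hy => by simp only [ENNReal.toReal_ofReal (hw0 y hy), smul_eq_mul]
  constructor
  · rw [integrable_map_measure hf.aestronglyMeasurable hhm,
      integrable_withDensity_iff_integrable_smul₀' hm hlt]
    refine IntegrableOn.congr_fun ?_ hcongr.symm hU
    exact integrableOn_of_continuousOn_of_compact hU hK hKU
      (hw.mul (hf.comp_continuousOn hh)) fun y hy hyK => by rw [hwK y hy hyK, zero_mul]
  · rw [integral_map hhm hf.aestronglyMeasurable,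
      integral_withDensity_eq_integral_toReal_smul₀ hm hlt]
    exact setIntegral_congr_fun hU hcongr

variable {k n : ℕ} {M : Type*} [TopologicalSpace M] [ChartedSpace (EuclideanHalfSpace (k + 1)) M]
  [IsManifold (𝓡∂ (k + 1)) ∞ M]

theorem integrableOn_chart [CompactSpace M] {ψ : M → 𝔼 n}
    (hψ : ContMDiff (𝓡∂ (k + 1)) 𝓘(ℝ, 𝔼 n) ∞ ψ)
    (hinj : ∀ p, Function.Injective (diffAt k ψ p)) {f : M → ℝ} (hf : Continuous f) {c : M}
    (hfc : tsupport f ⊆ (extChartAt (𝓡∂ (k + 1)) c).source) :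
    IntegrableOn (fun y => volDensity (chartDiff k ψ c y) *
      f ((extChartAt (𝓡∂ (k + 1)) c).symm y)) (extChartAt (𝓡∂ (k + 1)) c).target := by
  obtain ⟨K, hK, hKT, h0⟩ := exists_compact_of_tsupport_subset hfc
  exact integrableOn_of_continuousOn_of_compact (measurableSet_target c) hK hKT
    ((continuousOn_volDensity_chart hψ hinj c).mul
      (hf.comp_continuousOn (continuousOn_extChartAt_symm c)))
    fun y hy hyK => by rw [image_eq_zero_of_notMem_tsupport (h0 y hy hyK), mul_zero]

section Partition

variable [T2Space M] [CompactSpace M]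

theorem tsupport_chartPartition_subset (c : M) :
    tsupport (chartPartition k M c) ⊆ (extChartAt (𝓡∂ (k + 1)) c).source := by
  rw [extChartAt_source]
  exact Classical.choose_spec
    (SmoothPartitionOfUnity.exists_isSubordinate_chartAt_source (𝓡∂ (k + 1)) M) c

theorem finite_chartPartition (k : ℕ) (M : Type*) [TopologicalSpace M]
    [ChartedSpace (EuclideanHalfSpace (k + 1)) M] [IsManifold (𝓡∂ (k + 1)) ∞ M] [T2Space M]
    [CompactSpace M] :
    {c : M | (Function.support (chartPartition k M c)).Nonempty}.Finite :=
  (chartPartition k M).locallyFinite.finite_nonempty_of_compact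

/-- The finitely many indices of the nonzero members of the partition of unity. -/
def chartPartitionIndex (k : ℕ) (M : Type*) [TopologicalSpace M]
    [ChartedSpace (EuclideanHalfSpace (k + 1)) M] [IsManifold (𝓡∂ (k + 1)) ∞ M] [T2Space M]
    [CompactSpace M] : Finset M :=
  (finite_chartPartition k M).toFinset

theorem chartPartition_eq_zero {c : M} (hc : c ∉ chartPartitionIndex k M) (p : M) :
    chartPartition k M c p = 0 := by
  by_contra h
  exact hc ((Set.Finite.mem_toFinset _).2 ⟨p, h⟩)

theorem sum_chartPartition (p : M) :
    ∑ c ∈ chartPartitionIndex k M, chartPartition k M c p = 1 := by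
  rw [← (chartPartition k M).sum_eq_one (mem_univ p)]
  refine (finsum_eq_sum_of_support_subset _ fun c hc => ?_).symm
  by_contra h
  exact hc (chartPartition_eq_zero h p)

variable [MeasurableSpace M] [BorelSpace M]

/-- The Riemannian measure integrates continuous functions chart by chart. The sum over all points
of `M` that defines it is finite, by compactness. -/
theorem integral_areaMeasure {ψ : M → 𝔼 n} (hψ : ContMDiff (𝓡∂ (k + 1)) 𝓘(ℝ, 𝔼 n) ∞ ψ)
    (hinj : ∀ p, Function.Injective (diffAt k ψ p)) {f : M → ℝ} (hf : Continuous f) :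
    Integrable f (areaMeasure k ψ) ∧
    ∫ p, f p ∂areaMeasure k ψ = ∑ c ∈ chartPartitionIndex k M,
      ∫ y in (extChartAt (𝓡∂ (k + 1)) c).target,
        chartPartition k M c ((extChartAt (𝓡∂ (k + 1)) c).symm y) *
          volDensity (chartDiff k ψ c y) * f ((extChartAt (𝓡∂ (k + 1)) c).symm y) := by
  have hsum : areaMeasure k ψ = ∑ c ∈ chartPartitionIndex k M, _ :=
    measure_sum_eq_finsetSum fun c hc => by
      simp only [chartPartition_eq_zero hc, zero_mul, ENNReal.ofReal_zero]
      rw [show (fun _ : 𝔼 (k + 1) => (0 : ENNReal)) = 0 from rfl, withDensity_zero,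
        Measure.map_zero]
  choose K hK hKT h0 using fun c : M =>
    exists_compact_of_tsupport_subset (tsupport_chartPartition_subset (k := k) c)
  have hloc := fun c : M =>
    integral_map_withDensity (measurableSet_target c) (hK c) (hKT c)
      (continuousOn_extChartAt_symm c)
      (w := fun y => chartPartition k M c ((extChartAt (𝓡∂ (k + 1)) c).symm y) *
          volDensity (chartDiff k ψ c y))
      (((chartPartition k M c).contMDiff.continuous.comp_continuousOn
        (continuousOn_extChartAt_symm c)).mul (continuousOn_volDensity_chart hψ hinj c))
      (fun y _ => mul_nonneg ((chartPartition k M).nonneg c _) (volDensity_nonneg _))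
      (fun y hy hyK => by
        rw [image_eq_zero_of_notMem_tsupport (h0 c y hy hyK), zero_mul]) hf
  rw [hsum]
  exact ⟨integrable_finsetSum_measure.2 fun c _ => (hloc c).1,
    (integral_finsetSum_measure fun c _ => (hloc c).1).trans
      (Finset.sum_congr rfl fun c _ => (hloc c).2)⟩

theorem faceInclusion_isClosedEmbedding (k : ℕ) : IsClosedEmbedding (faceInclusion k) := by
  refine (AddMonoidHomClass.isometry_of_norm (faceInclusion k) fun z => ?_).isClosedEmbedding
  rw [EuclideanSpace.norm_eq, EuclideanSpace.norm_eq, Fin.sum_univ_succ]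
  simp

theorem integral_boundaryMeasure {ψ : M → 𝔼 n} (hψ : ContMDiff (𝓡∂ (k + 1)) 𝓘(ℝ, 𝔼 n) ∞ ψ)
    {f : M → ℝ} (hf : Continuous f) :
    Integrable f (boundaryMeasure k ψ) ∧
    ∫ p, f p ∂boundaryMeasure k ψ = ∑ c ∈ chartPartitionIndex k M,
      ∫ z in faceInclusion k ⁻¹' (extChartAt (𝓡∂ (k + 1)) c).target,
        chartPartition k M c ((extChartAt (𝓡∂ (k + 1)) c).symm (faceInclusion k z)) *
          volDensity (chartDiff k ψ c (faceInclusion k z) ∘L faceInclusion k) *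
            f ((extChartAt (𝓡∂ (k + 1)) c).symm (faceInclusion k z)) := by
  have hsum : boundaryMeasure k ψ = ∑ c ∈ chartPartitionIndex k M, _ :=
    measure_sum_eq_finsetSum fun c hc => by
      simp only [chartPartition_eq_zero hc, zero_mul, ENNReal.ofReal_zero]
      rw [show (fun _ : 𝔼 k => (0 : ENNReal)) = 0 from rfl, withDensity_zero,
        Measure.map_zero]
  choose K hK hKT h0 using fun c : M =>
    exists_compact_of_tsupport_subset (tsupport_chartPartition_subset (k := k) c)
  have hmaps : ∀ c : M, MapsTo (faceInclusion k)
      (faceInclusion k ⁻¹' (extChartAt (𝓡∂ (k + 1)) c).target)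
      (extChartAt (𝓡∂ (k + 1)) c).target := fun c => mapsTo_preimage _ _
  have hsymm := fun c : M => (continuousOn_extChartAt_symm (I := 𝓡∂ (k + 1)) c).comp
    (faceInclusion k).continuous.continuousOn (hmaps c)
  have hA : ∀ c : M, ContinuousOn (fun z => volDensity (chartDiff k ψ c (faceInclusion k z) ∘L
      faceInclusion k)) (faceInclusion k ⁻¹' (extChartAt (𝓡∂ (k + 1)) c).target) := by
    intro c
    have hv : Continuous (volDensity : (𝔼 k →L[ℝ] 𝔼 n) → ℝ) :=
      (contDiff_continuousLinearMap_det.comp contDiff_gramOp).continuous.sqrt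
    exact hv.comp_continuousOn ((((contDiffOn_chartDiff hψ c).continuousOn).comp
      (faceInclusion k).continuous.continuousOn (hmaps c)).clm_comp continuousOn_const)
  have hloc := fun c : M =>
    integral_map_withDensity ((faceInclusion k).continuous.measurable (measurableSet_target c))
      ((faceInclusion_isClosedEmbedding k).isCompact_preimage (hK c)) (preimage_mono (hKT c))
      (hsymm c)
      (w := fun z => chartPartition k M c
        ((extChartAt (𝓡∂ (k + 1)) c).symm (faceInclusion k z)) *
          volDensity (chartDiff k ψ c (faceInclusion k z) ∘L faceInclusion k))
      (((chartPartition k M c).contMDiff.continuous.comp_continuousOn (hsymm c)).mul (hA c))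
      (fun y _ => mul_nonneg ((chartPartition k M).nonneg c _) (volDensity_nonneg _))
      (fun y hy hyK => by
        rw [image_eq_zero_of_notMem_tsupport (h0 c _ hy hyK), zero_mul]) hf
  rw [hsum]
  exact ⟨integrable_finsetSum_measure.2 fun c _ => (hloc c).1,
    (integral_finsetSum_measure fun c _ => (hloc c).1).trans
      (Finset.sum_congr rfl fun c _ => (hloc c).2)⟩

end Partition

/-! ### Independence of the chart -/

/-- The Riemannian volume of a function supported in two chart domains is the same in both
charts. -/
theorem integral_chart_eq_integral_chart {ψ : M → 𝔼 n}
    (hψ : ContMDiff (𝓡∂ (k + 1)) 𝓘(ℝ, 𝔼 n) ∞ ψ) {f : M → ℝ} {c c' : M}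
    (hf : ∀ p, p ∉ (extChartAt (𝓡∂ (k + 1)) c).source ∩ (extChartAt (𝓡∂ (k + 1)) c').source →
      f p = 0) :
    ∫ y in (extChartAt (𝓡∂ (k + 1)) c).target, volDensity (chartDiff k ψ c y) *
        f ((extChartAt (𝓡∂ (k + 1)) c).symm y) =
      ∫ y in (extChartAt (𝓡∂ (k + 1)) c').target, volDensity (chartDiff k ψ c' y) *
        f ((extChartAt (𝓡∂ (k + 1)) c').symm y) := by
  set e := extChartAt (𝓡∂ (k + 1)) c with he
  set e' := extChartAt (𝓡∂ (k + 1)) c' with he'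
  set S := e.target ∩ e.symm ⁻¹' e'.source with hS
  set S' := e'.target ∩ e'.symm ⁻¹' e.source with hS'
  have h1 : ∫ y in e.target, volDensity (chartDiff k ψ c y) * f (e.symm y) =
      ∫ y in S, volDensity (chartDiff k ψ c y) * f (e.symm y) := by
    refine setIntegral_eq_of_subset_of_forall_sdiff_eq_zero (measurableSet_target c)
      inter_subset_left fun y hy => ?_
    rw [hf _ fun h => hy.2 ⟨hy.1, h.2⟩, mul_zero]
  have h2 : ∫ y in e'.target, volDensity (chartDiff k ψ c' y) * f (e'.symm y) =
      ∫ y in S', volDensity (chartDiff k ψ c' y) * f (e'.symm y) := by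
    refine setIntegral_eq_of_subset_of_forall_sdiff_eq_zero (measurableSet_target c')
      inter_subset_left fun y hy => ?_
    rw [hf _ fun h => hy.2 ⟨hy.1, h.1⟩, mul_zero]
  have hSm : MeasurableSet S := by
    obtain ⟨O, hO, hO'⟩ := continuousOn_iff'.1 (continuousOn_extChartAt_symm (I := 𝓡∂ (k + 1)) c)
      _ (isOpen_extChartAt_source (I := 𝓡∂ (k + 1)) c')
    rw [hS, inter_comm, hO']
    exact hO.measurableSet.inter (measurableSet_target c)
  have hSn : ∀ y ∈ S, S ∈ 𝓝[range (𝓡∂ (k + 1))] y := by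
    intro y hy
    rw [← nhdsWithin_extChartAt_target_eq_of_mem hy.1]
    exact inter_mem self_mem_nhdsWithin
      ((continuousOn_extChartAt_symm c y hy.1).preimage_mem_nhdsWithin
        ((isOpen_extChartAt_source (I := 𝓡∂ (k + 1)) c').mem_nhds hy.2))
  have himg : (e' ∘ e.symm) '' S = S' := by
    ext z
    constructor
    · rintro ⟨y, hy, rfl⟩
      refine ⟨e'.map_source hy.2, ?_⟩
      rw [mem_preimage, Function.comp_apply, e'.left_inv hy.2]
      exact e.map_target hy.1
    · intro hz
      refine ⟨e (e'.symm z), ⟨e.map_source hz.2, ?_⟩, ?_⟩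
      · rw [mem_preimage, e.left_inv hz.2]
        exact e'.map_target hz.1
      · rw [Function.comp_apply, e.left_inv hz.2, e'.right_inv hz.1]
  have hinjS : InjOn (e' ∘ e.symm) S := by
    intro y hy z hz hyz
    have := e'.injOn hy.2 hz.2 hyz
    exact e.symm.injOn hy.1 hz.1 this
  have hτ : ∀ y ∈ S, HasFDerivWithinAt (e' ∘ e.symm)
      (fderivWithin ℝ (e' ∘ e.symm) (range (𝓡∂ (k + 1))) y) (range (𝓡∂ (k + 1))) y := by
    intro y hy
    refine ((contDiffWithinAt_ext_coord_change (n := ∞) c' c ?_).differentiableWithinAt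
      (by simp)).hasFDerivWithinAt
    exact ⟨hy.1, hy.2⟩
  have hsub : S ⊆ range (𝓡∂ (k + 1)) := fun y hy => extChartAt_target_subset_range c hy.1
  have hψd : ∀ (d : M) (y : 𝔼 (k + 1)), y ∈ (extChartAt (𝓡∂ (k + 1)) d).target →
      HasFDerivWithinAt (ψ ∘ (extChartAt (𝓡∂ (k + 1)) d).symm) (chartDiff k ψ d y)
        (range (𝓡∂ (k + 1))) y := fun d y hy =>
    (((contDiffOn_comp_extChartAt_symm hψ d).differentiableOn (by simp) _ hy).mono_of_mem_nhdsWithin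
      (extChartAt_target_mem_nhdsWithin_of_mem hy)).hasFDerivWithinAt
  have hchain : ∀ y ∈ S, chartDiff k ψ c y = chartDiff k ψ c' ((e' ∘ e.symm) y) ∘L
      fderivWithin ℝ (e' ∘ e.symm) (range (𝓡∂ (k + 1))) y := by
    intro y hy
    have g1 : HasFDerivWithinAt ((ψ ∘ e'.symm) ∘ (e' ∘ e.symm)) _ S y :=
      (hψd c' _ (e'.map_source hy.2)).comp y ((hτ y hy).mono hsub) fun z hz =>
        extChartAt_target_subset_range c' (e'.map_source hz.2)
    have g2 : HasFDerivWithinAt (ψ ∘ e.symm) _ S y := g1.congr (fun z hz => by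
      simp only [Function.comp_apply, e'.left_inv hz.2]) (by
      simp only [Function.comp_apply, e'.left_inv hy.2])
    exact (g2.mono_of_mem_nhdsWithin (hSn y hy)).fderivWithin
      ((𝓡∂ (k + 1)).uniqueDiffOn _ (hsub hy))
  rw [h1, h2, ← himg, integral_image_eq_integral_abs_det_fderiv_smul volume hSm
    (fun y hy => (hτ y hy).mono hsub) hinjS]
  refine setIntegral_congr_fun hSm fun y hy => ?_
  rw [hchain y hy, volDensity_comp, Function.comp_apply, e'.left_inv hy.2, smul_eq_mul]
  ring

variable [T2Space M] [CompactSpace M] [MeasurableSpace M] [BorelSpace M]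

/-- The Riemannian integral of a function supported in a chart domain can be computed in that
chart. -/
theorem integral_areaMeasure_of_tsupport_subset {ψ : M → 𝔼 n}
    (hψ : ContMDiff (𝓡∂ (k + 1)) 𝓘(ℝ, 𝔼 n) ∞ ψ)
    (hinj : ∀ p, Function.Injective (diffAt k ψ p)) {f : M → ℝ} (hf : Continuous f) {c : M}
    (hfc : tsupport f ⊆ (extChartAt (𝓡∂ (k + 1)) c).source) :
    ∫ p, f p ∂areaMeasure k ψ = ∫ y in (extChartAt (𝓡∂ (k + 1)) c).target,
      volDensity (chartDiff k ψ c y) * f ((extChartAt (𝓡∂ (k + 1)) c).symm y) := by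
  have hcont : ∀ d : M, Continuous fun p => chartPartition k M d p * f p := fun d =>
    (chartPartition k M d).contMDiff.continuous.mul hf
  -- The part `ρ_d f` of the integral, computed in the chart around `d`, is moved to the chart
  -- around `c`.
  have hswap : ∀ d : M, ∫ y in (extChartAt (𝓡∂ (k + 1)) d).target,
        chartPartition k M d ((extChartAt (𝓡∂ (k + 1)) d).symm y) *
          volDensity (chartDiff k ψ d y) * f ((extChartAt (𝓡∂ (k + 1)) d).symm y) =
      ∫ y in (extChartAt (𝓡∂ (k + 1)) c).target, volDensity (chartDiff k ψ c y) *
        (chartPartition k M d ((extChartAt (𝓡∂ (k + 1)) c).symm y) *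
          f ((extChartAt (𝓡∂ (k + 1)) c).symm y)) := by
    intro d
    rw [integral_chart_eq_integral_chart (c := c) (c' := d) hψ
      (f := fun p => chartPartition k M d p * f p) fun p hp => ?_]
    · congr 1; ext y; ring
    · by_cases hpc : p ∈ tsupport f
      · have : p ∉ tsupport (chartPartition k M d) := fun h =>
          hp ⟨hfc hpc, tsupport_chartPartition_subset d h⟩
        rw [image_eq_zero_of_notMem_tsupport this, zero_mul]
      · rw [image_eq_zero_of_notMem_tsupport hpc, mul_zero]
  rw [(integral_areaMeasure hψ hinj hf).2, Finset.sum_congr rfl fun d _ => hswap d,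
    ← integral_finsetSum _ fun d _ => ?_]
  · refine setIntegral_congr_fun (measurableSet_target c) fun y _ => ?_
    rw [← Finset.mul_sum, ← Finset.sum_mul, sum_chartPartition, one_mul]
  · exact integrableOn_chart hψ hinj (hcont d)
      ((closure_mono (Function.support_mul_subset_right _ _)).trans hfc)

end Measures

/-! ### Calculus of tangent vector fields -/

section Calculus

variable {k n : ℕ} {M : Type*} [TopologicalSpace M] [ChartedSpace (EuclideanHalfSpace (k + 1)) M]
  {ψ : M → 𝔼 n}

theorem surfaceDivergence_sum {ι : Type*} {S : Finset ι} {Y : ι → M → 𝔼 n}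
    (hY : ∀ i ∈ S, ContMDiff (𝓡∂ (k + 1)) 𝓘(ℝ, 𝔼 n) ∞ (Y i)) (p : M) :
    surfaceDivergence k ψ (fun q => ∑ i ∈ S, Y i q) p =
      ∑ i ∈ S, surfaceDivergence k ψ (Y i) p := by
  have h1 : diffAt k (fun q => ∑ i ∈ S, Y i q) p = ∑ i ∈ S, diffAt k (Y i) p := by
    have h2 : HasMFDerivAt (𝓡∂ (k + 1)) 𝓘(ℝ, 𝔼 n) (fun q => ∑ i ∈ S, Y i q) p
        (∑ i ∈ S, diffAt k (Y i) p) :=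
      ⟨(continuous_finsetSum _ fun i hi => (hY i hi).continuous).continuousAt,
        HasFDerivWithinAt.fun_sum fun i hi =>
          ((hY i hi).mdifferentiable (by simp) p).hasMFDerivAt.2⟩
    rw [diffAt, h2.mfderiv]
    rfl
  let l : (𝔼 (k + 1) →L[ℝ] 𝔼 n) →ₗ[ℝ] ℝ :=
    { toFun := fun B => LinearMap.trace ℝ (𝔼 (k + 1))
        (tangentialPart (diffAt k ψ p) ∘L B : 𝔼 (k + 1) →L[ℝ] 𝔼 (k + 1))
      map_add' := fun B C => by
        rw [ContinuousLinearMap.comp_add, ContinuousLinearMap.toLinearMap_add, map_add]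
      map_smul' := fun a B => by
        rw [ContinuousLinearMap.comp_smul, ContinuousLinearMap.toLinearMap_smul, map_smul,
          RingHom.id_apply] }
  change l (diffAt k _ p) = ∑ i ∈ S, l (diffAt k (Y i) p)
  rw [h1, map_sum]

theorem surfaceDivergence_add {Y Z : M → 𝔼 n} (hY : ContMDiff (𝓡∂ (k + 1)) 𝓘(ℝ, 𝔼 n) ∞ Y)
    (hZ : ContMDiff (𝓡∂ (k + 1)) 𝓘(ℝ, 𝔼 n) ∞ Z) (p : M) :
    surfaceDivergence k ψ (fun q => Y q + Z q) p =
      surfaceDivergence k ψ Y p + surfaceDivergence k ψ Z p := by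
  have h := surfaceDivergence_sum (ψ := ψ) (S := Finset.univ) (Y := fun i : Fin 2 => ![Y, Z] i)
    (fun i _ => by fin_cases i <;> simpa) p
  simpa [Fin.sum_univ_two] using h

/-- The product rule `div(u ∇h) = u Δh + du(∇h)`. -/
theorem surfaceDivergence_smul_surfaceGradient (hinj : ∀ p, Function.Injective (diffAt k ψ p))
    {u h : M → ℝ} (hu : ContMDiff (𝓡∂ (k + 1)) 𝓘(ℝ, ℝ) ∞ u)
    (hh : ContMDiff (𝓡∂ (k + 1)) 𝓘(ℝ, 𝔼 n) ∞ (surfaceGradient k ψ h)) (p : M) :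
    surfaceDivergence k ψ (fun q => u q • surfaceGradient k ψ h q) p =
      u p * laplaceBeltrami k ψ h p +
        ⟪surfaceGradient k ψ u p, surfaceGradient k ψ h p⟫_ℝ := by
  have h1 : diffAt k (fun q => u q • surfaceGradient k ψ h q) p =
      u p • diffAt k (surfaceGradient k ψ h) p +
        (functionDiffAt k u p).smulRight (surfaceGradient k ψ h p) := by
    have a1 := (hu.mdifferentiable (by simp) p).hasMFDerivAt
    have a2 := (hh.mdifferentiable (by simp) p).hasMFDerivAt
    have a3 := a1.2.smul a2.2
    have a4 : HasMFDerivAt (𝓡∂ (k + 1)) 𝓘(ℝ, 𝔼 n) (fun q => u q • surfaceGradient k ψ h q) p _ :=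
      ⟨a1.1.smul a2.1, a3⟩
    rw [diffAt, a4.mfderiv]
    simp only [writtenInExtChartAt, Function.comp_apply, extChartAt_to_inv]
    rfl
  obtain ⟨ξ, hξ⟩ := surfaceGradient_mem_range (k := k) ψ h p
  have h2 : tangentialPart (diffAt k ψ p) ∘L diffAt k (fun q => u q • surfaceGradient k ψ h q) p =
      u p • (tangentialPart (diffAt k ψ p) ∘L diffAt k (surfaceGradient k ψ h) p) +
        (functionDiffAt k u p).smulRight ξ := by
    rw [h1, ← hξ]
    ext1 v
    simp only [ContinuousLinearMap.comp_apply, add_apply, smul_apply, map_add, map_smul,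
      ContinuousLinearMap.smulRight_apply, tangentialPart_apply_self (hinj p)]
  have h3 : LinearMap.trace ℝ (𝔼 (k + 1)) (((functionDiffAt k u p).smulRight ξ :
      𝔼 (k + 1) →L[ℝ] 𝔼 (k + 1)) : 𝔼 (k + 1) →ₗ[ℝ] 𝔼 (k + 1)) = functionDiffAt k u p ξ :=
    LinearMap.trace_smulRight (functionDiffAt k u p : 𝔼 (k + 1) →ₗ[ℝ] ℝ) ξ
  rw [surfaceDivergence, h2, ContinuousLinearMap.toLinearMap_add, map_add, h3,
    ContinuousLinearMap.toLinearMap_smul, map_smul, smul_eq_mul, ← hξ, inner_surfaceGradient hinj]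
  rfl

theorem surfaceGradient_const (a : ℝ) (p : M) :
    surfaceGradient k ψ (fun _ => a) p = 0 := by
  have h : functionDiffAt k (fun _ : M => a) p = 0 := by
    rw [functionDiffAt, mfderiv_const]
    rfl
  rw [surfaceGradient, h, map_zero, map_zero, map_zero]

theorem laplaceBeltrami_const (a : ℝ) (p : M) : laplaceBeltrami k ψ (fun _ => a) p = 0 := by
  refine surfaceDivergence_eq_zero_of_notMem_tsupport (notMem_tsupport_iff_eventuallyEq.2 ?_)
  exact Filter.Eventually.of_forall (surfaceGradient_const a)

theorem surfaceGradient_const_sub {h : M → ℝ} (hh : ContMDiff (𝓡∂ (k + 1)) 𝓘(ℝ, ℝ) ∞ h) (a : ℝ)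
    (p : M) : surfaceGradient k ψ (fun q => a - h q) p = -surfaceGradient k ψ h p := by
  have h1 : functionDiffAt k (fun q => a - h q) p = -functionDiffAt k h p := by
    have a1 := (hh.mdifferentiable (by simp) p).hasMFDerivAt
    have a2 : HasMFDerivAt (𝓡∂ (k + 1)) 𝓘(ℝ, ℝ) (fun q => a - h q) p _ :=
      ⟨a1.1.const_sub a, a1.2.const_sub a⟩
    rw [functionDiffAt, a2.mfderiv]
    rfl
  rw [surfaceGradient, h1, map_neg, map_neg, map_neg]
  rfl

end Calculus

/-! ### The divergence theorem -/

section DivergenceTheorem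

variable {k n : ℕ} {M : Type*} [TopologicalSpace M] [ChartedSpace (EuclideanHalfSpace (k + 1)) M]
  [IsManifold (𝓡∂ (k + 1)) ∞ M] [T2Space M] [CompactSpace M] [MeasurableSpace M] [BorelSpace M]

/-- The divergence theorem on a compact immersed hypersurface with boundary, for a smooth tangent
vector field `X` whose flux density through the boundary is the restriction of `g`. -/
theorem integral_surfaceDivergence {ψ X : M → 𝔼 n} (hψ : ContMDiff (𝓡∂ (k + 1)) 𝓘(ℝ, 𝔼 n) ∞ ψ)
    (hinj : ∀ p, Function.Injective (diffAt k ψ p))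
    (hX : ContMDiff (𝓡∂ (k + 1)) 𝓘(ℝ, 𝔼 n) ∞ X) (hXt : ∀ p, X p ∈ range (diffAt k ψ p))
    {ν : M → 𝔼 n} (hν : ∀ p ∈ (𝓡∂ (k + 1)).boundary M, IsOutwardConormal k ψ p (ν p))
    {g : M → ℝ} (hg : Continuous g) (hgν : ∀ p ∈ (𝓡∂ (k + 1)).boundary M, g p = ⟪X p, ν p⟫_ℝ) :
    ∫ p, surfaceDivergence k ψ X p ∂areaMeasure k ψ = ∫ p, g p ∂boundaryMeasure k ψ := by
  let Y : M → M → 𝔼 n := fun c p => chartPartition k M c p • X p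
  have hY : ∀ c, ContMDiff (𝓡∂ (k + 1)) 𝓘(ℝ, 𝔼 n) ∞ (Y c) := fun c =>
    (chartPartition k M c).contMDiff.smul hX
  have hYt : ∀ c p, Y c p ∈ range (diffAt k ψ p) := fun c p => by
    obtain ⟨u, hu⟩ := hXt p
    exact ⟨chartPartition k M c p • u, by rw [map_smul, hu]⟩
  have hYs : ∀ c, tsupport (Y c) ⊆ (extChartAt (𝓡∂ (k + 1)) c).source := fun c =>
    (closure_mono (Function.support_smul_subset_left _ _)).trans (tsupport_chartPartition_subset c)
  have hdivc : ∀ c, Continuous (surfaceDivergence k ψ (Y c)) := fun c =>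
    continuous_surfaceDivergence hψ hinj (hY c)
  have hdivs : ∀ c, tsupport (surfaceDivergence k ψ (Y c)) ⊆
      (extChartAt (𝓡∂ (k + 1)) c).source := fun c =>
    (closure_minimal (fun p hp => by
      by_contra h
      exact hp (surfaceDivergence_eq_zero_of_notMem_tsupport h))
        (isClosed_tsupport _)).trans (hYs c)
  have hsum : surfaceDivergence k ψ X =
      fun p => ∑ c ∈ chartPartitionIndex k M, surfaceDivergence k ψ (Y c) p := by
    ext p
    rw [← surfaceDivergence_sum fun c _ => hY c]
    congr 1
    ext1 q
    simp only [Y]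
    rw [← Finset.sum_smul, sum_chartPartition, one_smul]
  rw [hsum, integral_finsetSum _ fun c _ => (integral_areaMeasure hψ hinj (hdivc c)).1,
    (integral_boundaryMeasure hψ hg).2]
  refine Finset.sum_congr rfl fun c _ => ?_
  rw [integral_areaMeasure_of_tsupport_subset hψ hinj (hdivc c) (hdivs c),
    integral_surfaceDivergence_chart hψ hinj (hY c) (hYt c) (hYs c) hν]
  refine setIntegral_congr_fun ((faceInclusion k).continuous.measurable (measurableSet_target c))
    fun z hz => ?_
  simp only [Y]
  rw [hgν _ (mem_boundary_of_coord_eq_zero hz (faceInclusion_zero z)), real_inner_smul_left]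
  ring

end DivergenceTheorem

end

/-! ### The integral formula -/

theorem mainTheorem2 {k : ℕ}
    (Ω : Set (EuclideanSpace ℝ (Fin (k + 2)))) (hΩo : IsOpen Ω) (hΩc : IsConnected Ω)
    (F : EuclideanSpace ℝ (Fin (k + 2)) → ℝ) (hF : ContDiff ℝ ∞ F)
    (hreg : ∀ x, F x = 1 → Function.Surjective (fderiv ℝ F x))
    (hfr : frontier Ω = F ⁻¹' {1})
    (N : EuclideanSpace ℝ (Fin (k + 2)) → EuclideanSpace ℝ (Fin (k + 2)))
    (hN : ∀ x ∈ frontier Ω, IsOutwardUnitNormal Ω x (N x))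
    (hNF : ∀ x ∈ frontier Ω, N x = ‖gradient F x‖⁻¹ • gradient F x)
    {M : Type*} [TopologicalSpace M] [T2Space M] [CompactSpace M]
    [ChartedSpace (EuclideanHalfSpace (k + 1)) M] [IsManifold (𝓡∂ (k + 1)) ∞ M]
    [MeasurableSpace M] [BorelSpace M]
    (ψ : M → EuclideanSpace ℝ (Fin (k + 2))) (hψ : IsFreeBoundaryHypersurface Ω N ψ) :
    (∀ φ : M → ℝ, ContMDiff (𝓡∂ (k + 1)) 𝓘(ℝ, ℝ) ∞ φ →
      Integrable (fun p => ‖gradient F (ψ p)‖ * φ p) (boundaryMeasure k ψ) ∧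
      Integrable (fun p => φ p * laplaceBeltrami k ψ (F ∘ ψ) p) (areaMeasure k ψ) ∧
      Integrable (fun p => (1 - F (ψ p)) * laplaceBeltrami k ψ φ p) (areaMeasure k ψ) ∧
      ∫ p, ‖gradient F (ψ p)‖ * φ p ∂boundaryMeasure k ψ =
        ∫ p, φ p * laplaceBeltrami k ψ (F ∘ ψ) p ∂areaMeasure k ψ +
          ∫ p, (1 - F (ψ p)) * laplaceBeltrami k ψ φ p ∂areaMeasure k ψ) ∧
    ∫ p, ‖gradient F (ψ p)‖ ∂boundaryMeasure k ψ =
      ∫ p, laplaceBeltrami k ψ (F ∘ ψ) p ∂areaMeasure k ψ := by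
  have hs := hψ.smooth
  have hinj := hψ.immersion
  have hf : ContMDiff (𝓡∂ (k + 1)) 𝓘(ℝ, ℝ) ∞ (F ∘ ψ) := hF.contMDiff.comp hs
  have hgradF : Continuous fun x => gradient F x :=
    (InnerProductSpace.toDual ℝ (EuclideanSpace ℝ (Fin (k + 2)))).symm.continuous.comp
      (hF.continuous_fderiv (by simp))
  have hlap : ∀ h : M → ℝ, ContMDiff (𝓡∂ (k + 1)) 𝓘(ℝ, ℝ) ∞ h →
      Continuous (laplaceBeltrami k ψ h) :=
    fun h hh => continuous_surfaceDivergence hs hinj (contMDiff_surfaceGradient hs hinj hh)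
  have main : ∀ φ : M → ℝ, ContMDiff (𝓡∂ (k + 1)) 𝓘(ℝ, ℝ) ∞ φ →
      Integrable (fun p => ‖gradient F (ψ p)‖ * φ p) (boundaryMeasure k ψ) ∧
      Integrable (fun p => φ p * laplaceBeltrami k ψ (F ∘ ψ) p) (areaMeasure k ψ) ∧
      Integrable (fun p => (1 - F (ψ p)) * laplaceBeltrami k ψ φ p) (areaMeasure k ψ) ∧
      ∫ p, ‖gradient F (ψ p)‖ * φ p ∂boundaryMeasure k ψ =
        ∫ p, φ p * laplaceBeltrami k ψ (F ∘ ψ) p ∂areaMeasure k ψ +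
          ∫ p, (1 - F (ψ p)) * laplaceBeltrami k ψ φ p ∂areaMeasure k ψ := by
    intro φ hφ
    have hg : Continuous fun p => ‖gradient F (ψ p)‖ * φ p :=
      (hgradF.comp hs.continuous).norm.mul hφ.continuous
    have hI1 := (integral_areaMeasure hs hinj (hφ.continuous.mul (hlap _ hf)) (f := fun p =>
        φ p * laplaceBeltrami k ψ (F ∘ ψ) p)).1
    have hI2 := (integral_areaMeasure hs hinj
      ((continuous_const.sub hf.continuous).mul (hlap _ hφ)) (f := fun p =>
        (1 - F (ψ p)) * laplaceBeltrami k ψ φ p)).1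
    refine ⟨(integral_boundaryMeasure hs hg).1, hI1, hI2, ?_⟩
    have hu : ContMDiff (𝓡∂ (k + 1)) 𝓘(ℝ, ℝ) ∞ fun p => 1 - (F ∘ ψ) p := contMDiff_const.sub hf
    have hgf := contMDiff_surfaceGradient hs hinj hf
    have hgφ := contMDiff_surfaceGradient hs hinj hφ
    have hX1 : ContMDiff (𝓡∂ (k + 1)) 𝓘(ℝ, EuclideanSpace ℝ (Fin (k + 2))) ∞
        fun p => φ p • surfaceGradient k ψ (F ∘ ψ) p := hφ.smul hgf
    have hX2 : ContMDiff (𝓡∂ (k + 1)) 𝓘(ℝ, EuclideanSpace ℝ (Fin (k + 2))) ∞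
        fun p => (1 - (F ∘ ψ) p) • surfaceGradient k ψ φ p := hu.smul hgφ
    -- The two terms `⟪∇φ, ∇F⟫` cancel in the divergence of `φ ∇F + (1 - F) ∇φ`.
    have hdiv : ∀ p, surfaceDivergence k ψ (fun p => φ p • surfaceGradient k ψ (F ∘ ψ) p +
        (1 - (F ∘ ψ) p) • surfaceGradient k ψ φ p) p =
        φ p * laplaceBeltrami k ψ (F ∘ ψ) p + (1 - F (ψ p)) * laplaceBeltrami k ψ φ p := by
      intro p
      rw [surfaceDivergence_add hX1 hX2, surfaceDivergence_smul_surfaceGradient hinj hφ hgf,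
        surfaceDivergence_smul_surfaceGradient hinj hu hgφ, surfaceGradient_const_sub hf,
        inner_neg_left, real_inner_comm (surfaceGradient k ψ φ p)]
      simp only [Function.comp_apply]
      ring
    have hdt := integral_surfaceDivergence hs hinj (hX1.add hX2) (fun p => by
      obtain ⟨a, ha⟩ := surfaceGradient_mem_range (k := k) ψ (F ∘ ψ) p
      obtain ⟨b, hb⟩ := surfaceGradient_mem_range (k := k) ψ φ p
      exact ⟨φ p • a + (1 - (F ∘ ψ) p) • b, by rw [map_add, map_smul, map_smul, ha, hb]; rfl⟩)
      -- On the boundary `F = 1`, so only `φ ⟪∇F, ν⟫ = φ dF(ν)` with `ν = ∇F / |∇F|` remains.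
      hψ.conormal_eq hg (fun p hp => by
        have hpΩ := hψ.boundary_mem_frontier p hp
        have hF1 : F (ψ p) = 1 := by
          rw [hfr] at hpΩ
          exact hpΩ
        obtain ⟨w, -, hw⟩ := (hψ.conormal_eq p hp).tangent_outward
        have hchain : functionDiffAt k (F ∘ ψ) p = fderiv ℝ F (ψ p) ∘L diffAt k ψ p := by
          rw [functionDiffAt, mfderiv_comp p
            ((hF.contMDiff.mdifferentiable (by simp)) (ψ p)) (hs.mdifferentiable (by simp) p),
            mfderiv_eq_fderiv]
          rfl
        change _ = ⟪φ p • surfaceGradient k ψ (F ∘ ψ) p +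
          (1 - (F ∘ ψ) p) • surfaceGradient k ψ φ p, N (ψ p)⟫_ℝ
        rw [Function.comp_apply, hF1, sub_self, zero_smul, add_zero, real_inner_smul_left, ← hw,
          inner_surfaceGradient hinj, hchain, ContinuousLinearMap.comp_apply, hw,
          ← inner_gradient_left, hNF _ hpΩ, real_inner_smul_right, real_inner_self_eq_norm_sq]
        by_cases h0 : ‖gradient F (ψ p)‖ = 0
        · simp [h0]
        · field_simp)
    rw [← hdt, ← integral_add hI1 hI2]
    exact integral_congr_ae (Filter.Eventually.of_forall hdiv)
  refine ⟨main, ?_⟩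
  have h1 := (main (fun _ => 1) contMDiff_const).2.2.2
  simpa [laplaceBeltrami_const] using h1
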